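/- For a nonempty sequence $W = w_1,\dots,w_n$ of real weights, an alphabetic minimax tree for $W$ is an ordered binary tree (each internal node has one or two children) with $n$ leaves, of depths $\ell_1,\dots,\ell_n$ from left to right, that minimizes $\max_{1\le i\le n}(w_i+\ell_i)$; the minimum is denoted $\alpha(W)$. Let $d$ be the number of distinct integers among $\lceil w_1\rceil,\dots,\lceil w_n\rceil$, and let $\log=\log_2$. Suppose that we are given, for every $W$, a data structure that stores $W$ and $X=x_1,\dots,x_n$, where initially $X = 0,\dots,0$, and supports the operations $\mathsf{set}(i)$ (set $x_i$ to $1$), $\mathsf{undo}$ (undo the last $\mathsf{set}$ operation that has not been undone; allowed only if there is one) and $\mathsf{cost}$ (return $\alpha(\lceil w_1\rceil-x_1,\dots,\lceil w_n\rceil-x_n)$), and that any sequence of $O(n)$ operations on it takes $O(n\,d\log\log n)$ time in total, including the time for building it: for every $K$ there is a $C$ such that, for all $W$ with $n\ge 3$, any sequence of at most $Kn$ operations takes time at most $C\,n\,d\log\log n$. Then an alphabetic minimax tree for $W$ can be built in $O(n\,d\log\log n)$ time. That is, there is a single program, independent of $W$ and of the data structure, which, when it is run on any nonempty $W$ with such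 a data structure for $W$, outputs an alphabetic minimax tree for $W$, and for which there is a $C'$ (depending only on the given data structures, not on $W$) such that, whenever $n\ge 3$, the total time, including the time taken by the data structure, is at most $C'\,n\,d\log\log n$. Here a program is a finite system of first-order recursive functions over lists and pairs built from real numbers, with unit-cost steps (variable access, integer constants, pairing and projections, addition, subtraction, floor, comparison of real numbers, test for the empty list, local definition, function call), which in addition may call the operations of the data structure; such a call costs one step plus the time that the data structure takes. -/

import Mathlib

namespace AlphabeticMinimax

/-! ## Alphabetic minimax trees -/

/-- Ordered binary trees: an internal node has one or two children, ordered from left to right. -/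
inductive Tree where
  | leaf : Tree
  | unary : Tree → Tree
  | binary : Tree → Tree → Tree

/-- The depths of the leaves, from left to right (the root has depth `0`). -/
def Tree.depths : Tree → List ℕ
  | .leaf => [0]
  | .unary t => t.depths.map (· + 1)
  | .binary l r => (l.depths ++ r.depths).map (· + 1)

/-- `max_i (w_i + ℓ_i)`, where `ℓ_1, …, ℓ_n` are the depths of the leaves of `T`.  It is used only
for trees with as many leaves as there are weights, so that it is the maximum of a nonempty
finite set. -/
noncomputable def treeCost (W : List ℝ) (T : Tree) : ℝ :=
  sSup {c : ℝ | c ∈ List.zipWith (fun (w : ℝ) (l : ℕ) => w + (l : ℝ)) W T.depths}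

/-- `T` is an alphabetic minimax tree for `W`. -/
def IsMinimaxTree (W : List ℝ) (T : Tree) : Prop :=
  T.depths.length = W.length ∧
    ∀ T' : Tree, T'.depths.length = W.length → treeCost W T ≤ treeCost W T'

/-- `c` is the alphabetic minimax cost `α(W)`. -/
def IsMinimaxCost (W : List ℝ) (c : ℝ) : Prop :=
  IsLeast {x : ℝ | ∃ T : Tree, T.depths.length = W.length ∧ x = treeCost W T} c

/-- The number `d` of distinct integers `⌈w_i⌉`. -/
noncomputable def numCeils (W : List ℝ) : ℕ :=
  (W.map (fun w => ⌈w⌉)).toFinset.card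

/-- `n d log log n`, with logarithms to base two. -/
noncomputable def bound (W : List ℝ) : ℝ :=
  (W.length : ℝ) * (numCeils W : ℝ) * Real.logb 2 (Real.logb 2 (W.length : ℝ))

/-! ## Data structures with the operations `set`, `undo` and `cost` -/

/-- The operations, for a sequence of `n` weights (positions are counted from `0` here). -/
inductive Op (n : ℕ) where
  | set (i : Fin n) : Op n
  | undo : Op n
  | cost : Op n

/-- The intended effect of an operation.  The list holds the positions given to the `set`
operations that have not been undone, the most recent one first; thus `x_i = 1` if and only if `i`
is in it.  There must be something to undo when `undo` is called. -/
def Op.effect {n : ℕ} (stack : List (Fin n)) : Op n → Option (List (Fin n))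
  | .set i => some (i :: stack)
  | .undo =>
    match stack with
    | [] => none
    | _ :: rest => some rest
  | .cost => some stack

/-- The effect of a sequence of operations, starting from `X = 0, …, 0`; it is `none` if some
`undo` has nothing to undo. -/
def effects {n : ℕ} (ops : List (Op n)) : Option (List (Fin n)) :=
  ops.foldlM Op.effect []

/-- The sequence `⌈w_1⌉ - x_1, …, ⌈w_n⌉ - x_n`. -/
noncomputable def shifted (W : List ℝ) (stack : List (Fin W.length)) : List ℝ :=
  List.ofFn (fun i : Fin W.length => (⌈W.get i⌉ : ℝ) - (if i ∈ stack then 1 else 0))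

/-- A data structure for the sequence `W`, as its users see it: an arbitrary internal state,
the time for building the initial state, and, for each operation carried out in
a given state, the next state and the time taken; `answer s` is what `cost` returns in the
state `s`. -/
structure DataStructure (W : List ℝ) where
  State : Type
  init : State
  buildTime : ℕ
  next : State → Op W.length → State
  time : State → Op W.length → ℕ
  answer : State → ℝ

namespace DataStructure

variable {W : List ℝ} (D : DataStructure W)

/-- The state that a sequence of operations leads to. -/
def stateAfter (ops : List (Op W.length)) : D.State :=
  ops.foldl D.next D.init

/-- The time for a sequence of operations that starts in the state `s`. -/
def timeFrom (s : D.State) : List (Op W.length) → ℕ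
  | [] => 0
  | op :: ops => D.time s op + timeFrom (D.next s op) ops

/-- The time for building the data structure and performing a sequence of operations on it. -/
def totalTime (ops : List (Op W.length)) : ℕ :=
  D.buildTime + D.timeFrom D.init ops

/-- After every meaningful sequence of operations, `cost` would return
`α(⌈w_1⌉ - x_1, …, ⌈w_n⌉ - x_n)`. -/
def Correct : Prop :=
  ∀ (ops : List (Op W.length)) (stack : List (Fin W.length)), effects ops = some stack →
    IsMinimaxCost (shifted W stack) (D.answer (D.stateAfter ops))

end DataStructure

/-- Any `O(n)` operations take `O(n d log log n)` time: for every `K` there is a `C` such that any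
sequence of at most `K n` operations takes time at most `C n d log log n`.
(`log log n` is positive from `n = 3` on.) -/
def FastOnLinearSequences (D : (W : List ℝ) → DataStructure W) : Prop :=
  ∀ K : ℕ, ∃ C : ℝ, ∀ W : List ℝ, 3 ≤ W.length →
    ∀ ops : List (Op W.length), (effects ops).isSome → ops.length ≤ K * W.length →
      ((D W).totalTime ops : ℝ) ≤ C * bound W

/-! ## The model of computation

Programs are first-order recursive functions, evaluated by value, over S-expressions whose atoms
are `nil` and the real numbers.  Every evaluation step takes unit time, except that the time of an
operation on the data structure is added to it.  All steps take constant time on a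
unit-cost random access machine with real registers and the floor function. -/

/-- Values: S-expressions with real numbers (and `nil`) as atoms. -/
inductive Val where
  | nil : Val
  | num (r : ℝ) : Val
  | pair (a b : Val) : Val

/-- Expressions.  Variables are de Bruijn indices.  The last three are the calls to the
data structure. -/
inductive Expr where
  | var (i : ℕ) : Expr
  | nil : Expr
  | int (z : ℤ) : Expr
  | pair (a b : Expr) : Expr
  | fst (a : Expr) : Expr
  | snd (a : Expr) : Expr
  | add (a b : Expr) : Expr
  | sub (a b : Expr) : Expr
  | floor (a : Expr) : Expr
  | ifNil (c a b : Expr) : Expr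
  | ifLt (x y a b : Expr) : Expr
  | bind (a b : Expr) : Expr
  | call (f : ℕ) (a : Expr) : Expr
  | set (a : Expr) : Expr
  | undo : Expr
  | cost : Expr

/-- A program: the bodies of finitely many (mutually recursive) functions of one variable, and a
main expression, whose variable `0` is the input. -/
structure Program where
  functions : List Expr
  main : Expr

/-- `Eval F D env e s v s' t`: with the function bodies `F`, the data structure `D` in the state `s`
and the values `env` of the variables, the evaluation of `e` ends, with the value `v` and with the
data structure in the state `s'`, and takes time `t`. -/
inductive Eval (F : List Expr) {W : List ℝ} (D : DataStructure W) :
    List Val → Expr → D.State → Val → D.State → ℕ → Prop where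
  | var {env : List Val} {i : ℕ} {s : D.State} {v : Val} (h : env[i]? = some v) :
      Eval F D env (.var i) s v s 1
  | nil {env : List Val} {s : D.State} :
      Eval F D env .nil s .nil s 1
  | int {env : List Val} {s : D.State} {z : ℤ} :
      Eval F D env (.int z) s (.num (z : ℝ)) s 1
  | pair {env : List Val} {a b : Expr} {s₀ s₁ s₂ : D.State} {u v : Val} {t₁ t₂ : ℕ}
      (ha : Eval F D env a s₀ u s₁ t₁) (hb : Eval F D env b s₁ v s₂ t₂) :
      Eval F D env (.pair a b) s₀ (.pair u v) s₂ (t₁ + t₂ + 1)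
  | fst {env : List Val} {a : Expr} {s₀ s₁ : D.State} {u v : Val} {t : ℕ}
      (ha : Eval F D env a s₀ (.pair u v) s₁ t) :
      Eval F D env (.fst a) s₀ u s₁ (t + 1)
  | snd {env : List Val} {a : Expr} {s₀ s₁ : D.State} {u v : Val} {t : ℕ}
      (ha : Eval F D env a s₀ (.pair u v) s₁ t) :
      Eval F D env (.snd a) s₀ v s₁ (t + 1)
  | add {env : List Val} {a b : Expr} {s₀ s₁ s₂ : D.State} {x y : ℝ} {t₁ t₂ : ℕ}
      (ha : Eval F D env a s₀ (.num x) s₁ t₁) (hb : Eval F D env b s₁ (.num y) s₂ t₂) :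
      Eval F D env (.add a b) s₀ (.num (x + y)) s₂ (t₁ + t₂ + 1)
  | sub {env : List Val} {a b : Expr} {s₀ s₁ s₂ : D.State} {x y : ℝ} {t₁ t₂ : ℕ}
      (ha : Eval F D env a s₀ (.num x) s₁ t₁) (hb : Eval F D env b s₁ (.num y) s₂ t₂) :
      Eval F D env (.sub a b) s₀ (.num (x - y)) s₂ (t₁ + t₂ + 1)
  | floor {env : List Val} {a : Expr} {s₀ s₁ : D.State} {x : ℝ} {t : ℕ}
      (ha : Eval F D env a s₀ (.num x) s₁ t) :
      Eval F D env (.floor a) s₀ (.num (⌊x⌋ : ℝ)) s₁ (t + 1)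
  | ifNil_nil {env : List Val} {c a b : Expr} {s₀ s₁ s₂ : D.State} {v : Val} {t₁ t₂ : ℕ}
      (hc : Eval F D env c s₀ .nil s₁ t₁) (ha : Eval F D env a s₁ v s₂ t₂) :
      Eval F D env (.ifNil c a b) s₀ v s₂ (t₁ + t₂ + 1)
  | ifNil_not {env : List Val} {c a b : Expr} {s₀ s₁ s₂ : D.State} {u v : Val} {t₁ t₂ : ℕ}
      (hc : Eval F D env c s₀ u s₁ t₁) (hu : u ≠ .nil) (hb : Eval F D env b s₁ v s₂ t₂) :
      Eval F D env (.ifNil c a b) s₀ v s₂ (t₁ + t₂ + 1)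
  | ifLt_lt {env : List Val} {c₁ c₂ a b : Expr} {s₀ s₁ s₂ s₃ : D.State} {x y : ℝ} {v : Val}
      {t₁ t₂ t₃ : ℕ}
      (hx : Eval F D env c₁ s₀ (.num x) s₁ t₁) (hy : Eval F D env c₂ s₁ (.num y) s₂ t₂)
      (hxy : x < y) (ha : Eval F D env a s₂ v s₃ t₃) :
      Eval F D env (.ifLt c₁ c₂ a b) s₀ v s₃ (t₁ + t₂ + t₃ + 1)
  | ifLt_not {env : List Val} {c₁ c₂ a b : Expr} {s₀ s₁ s₂ s₃ : D.State} {x y : ℝ} {v : Val}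
      {t₁ t₂ t₃ : ℕ}
      (hx : Eval F D env c₁ s₀ (.num x) s₁ t₁) (hy : Eval F D env c₂ s₁ (.num y) s₂ t₂)
      (hxy : y ≤ x) (hb : Eval F D env b s₂ v s₃ t₃) :
      Eval F D env (.ifLt c₁ c₂ a b) s₀ v s₃ (t₁ + t₂ + t₃ + 1)
  | bind {env : List Val} {a b : Expr} {s₀ s₁ s₂ : D.State} {u v : Val} {t₁ t₂ : ℕ}
      (ha : Eval F D env a s₀ u s₁ t₁) (hb : Eval F D (u :: env) b s₁ v s₂ t₂) :
      Eval F D env (.bind a b) s₀ v s₂ (t₁ + t₂ + 1)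
  | call {env : List Val} {f : ℕ} {a body : Expr} {s₀ s₁ s₂ : D.State} {u v : Val} {t₁ t₂ : ℕ}
      (hf : F[f]? = some body) (ha : Eval F D env a s₀ u s₁ t₁)
      (hb : Eval F D [u] body s₁ v s₂ t₂) :
      Eval F D env (.call f a) s₀ v s₂ (t₁ + t₂ + 1)
  /-- The argument of `set` is one of the numbers `1, …, n`. -/
  | set {env : List Val} {a : Expr} {s₀ s₁ : D.State} {i : Fin W.length} {t : ℕ}
      (ha : Eval F D env a s₀ (.num (((i : ℕ) : ℝ) + 1)) s₁ t) :
      Eval F D env (.set a) s₀ .nil (D.next s₁ (.set i)) (t + D.time s₁ (.set i) + 1)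
  | undo {env : List Val} {s : D.State} :
      Eval F D env .undo s .nil (D.next s .undo) (D.time s .undo + 1)
  | cost {env : List Val} {s : D.State} :
      Eval F D env .cost s (.num (D.answer s)) (D.next s .cost) (D.time s .cost + 1)

/-- The representation of a sequence of real numbers by a value. -/
def encodeList : List ℝ → Val
  | [] => .nil
  | w :: W => .pair (.num w) (encodeList W)

/-- The representation of a tree by a value; different trees have different representations. -/
def encodeTree : Tree → Val
  | .leaf => .num 0
  | .unary t => .pair (encodeTree t) .nil
  | .binary l r => .pair (encodeTree l) (encodeTree r)

/-- Given `W` and the data structure `D` for `W`, the program `P` outputs the tree `T`, in time `t`;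
this includes the time taken by `D`, from its building on. -/
def Program.Builds (P : Program) {W : List ℝ} (D : DataStructure W) (T : Tree) (t : ℕ) : Prop :=
  ∃ (s : D.State) (t' : ℕ),
    Eval P.functions D [encodeList W] P.main D.init (encodeTree T) s t' ∧ t = D.buildTime + t'

end AlphabeticMinimax

/-! Write `gap W i` for `⌈w_i⌉ - w_i`, which lies in `[0, 1)`, and let `m` be the minimax cost of
the rounded weights, an integer. For a gap `θ`, a tree satisfies `w_i + ℓ_i ≤ m - θ` for all `i`
exactly when `⌈w_i⌉ - x_i + ℓ_i ≤ m - 1` for all `i`, where `x_i = 1` if `gap W i ≥ θ` and `x_i = 0`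
otherwise. So `α(W) = m - θ` for the largest gap `θ` at which setting all positions with gap at
least `θ` brings the cost below `m`: `exists_tree_of_threshold` gives a tree of that cost and
`le_treeCost_of_threshold` the lower bound.

The threshold is found by binary search over the gaps (`fn_search`). Each round takes an approximate
median of the remaining gaps (`exists_pivot`, resting on the linear-time selection `selects`), sets
the larger ones and asks for the cost. A constant fraction of the items is dropped each time, so
both the steps and the operations on the data structure are linear in `n`.

Once `c = α(W)` is known, a tree whose `i`-th leaf has depth at most `⌊c - w_i⌋` is needed. Leaves
are identified with dyadic intervals of length `2 ^ (-depth)`, packed greedily from left to right;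
the stack of maximal subtrees behaves like a binary counter. The packing never ends further right
than that of any feasible tree (`value_insertLeaves_le`), so it stays within the unit interval, and
the amortized work is linear (`fn_build`).

The linear overhead is absorbed into the bound because `n / 2 ≤ n d log log n` for `n ≥ 3`
(`half_length_le_bound`). -/

namespace AlphabeticMinimax

/-! ## Evaluation along sequences of operations -/

section Evaluation

variable {F : List Expr} {W : List ℝ} {D : DataStructure W}

theorem DataStructure.timeFrom_append (D : DataStructure W) (s : D.State)
    (ops ops' : List (Op W.length)) :
    D.timeFrom s (ops ++ ops') = D.timeFrom s ops + D.timeFrom (ops.foldl D.next s) ops' := by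
  induction ops generalizing s with
  | nil => simp [DataStructure.timeFrom]
  | cons op ops ih => simp [DataStructure.timeFrom, ih, add_assoc]

theorem DataStructure.stateAfter_concat (D : DataStructure W) (ops : List (Op W.length))
    (op : Op W.length) : D.stateAfter (ops ++ [op]) = D.next (D.stateAfter ops) op := by
  simp [DataStructure.stateAfter]

theorem DataStructure.timeFrom_concat (D : DataStructure W) (ops : List (Op W.length))
    (op : Op W.length) :
    D.timeFrom D.init (ops ++ [op]) = D.timeFrom D.init ops + D.time (D.stateAfter ops) op := by
  simp [DataStructure.timeFrom_append, DataStructure.timeFrom, DataStructure.stateAfter]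

/-- The evaluation of `e`, after the operations `ops`, extends them to `ops'`, returns `v`, and
takes at most `c` steps in addition to the time of the data structure. -/
def Ev (F : List Expr) {W : List ℝ} (D : DataStructure W) (env : List Val) (e : Expr)
    (ops : List (Op W.length)) (v : Val) (ops' : List (Op W.length)) (c : ℕ) : Prop :=
  ∃ t, Eval F D env e (D.stateAfter ops) v (D.stateAfter ops') t ∧
    t + D.timeFrom D.init ops ≤ c + D.timeFrom D.init ops'

/-- A call of the function `f` with the argument `u`. -/
def Fn (F : List Expr) {W : List ℝ} (D : DataStructure W) (f : ℕ) (u : Val)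
    (ops : List (Op W.length)) (v : Val) (ops' : List (Op W.length)) (c : ℕ) : Prop :=
  ∃ body, F[f]? = some body ∧ Ev F D [u] body ops v ops' c

variable {env : List Val} {a b e : Expr} {u v v' : Val}
  {ops ops₁ ops₂ ops₃ : List (Op W.length)} {c c₁ c₂ c₃ : ℕ}

theorem Ev.mono (h : Ev F D env e ops v ops₁ c) (hc : c ≤ c₁) : Ev F D env e ops v ops₁ c₁ := by
  obtain ⟨t, h, ht⟩ := h
  exact ⟨t, h, by omega⟩

theorem Ev.cast (h : Ev F D env e ops v ops₁ c) (hv : v = v') (hc : c ≤ c₁) :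
    Ev F D env e ops v' ops₁ c₁ :=
  hv ▸ h.mono hc

theorem Fn.cast {f : ℕ} (h : Fn F D f u ops v ops₁ c) (hv : v = v') (hc : c ≤ c₁) :
    Fn F D f u ops v' ops₁ c₁ := by
  obtain ⟨body, hf, h⟩ := h
  exact ⟨body, hf, h.cast hv hc⟩

/-- The value of an expression without branches, definitions and calls. -/
noncomputable def pureVal (env : List Val) : Expr → Option Val
  | .var i => env[i]?
  | .nil => some .nil
  | .int z => some (.num z)
  | .pair a b =>
    match pureVal env a, pureVal env b with
    | some u, some v => some (.pair u v)
    | _, _ => none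
  | .fst a =>
    match pureVal env a with
    | some (.pair u _) => some u
    | _ => none
  | .snd a =>
    match pureVal env a with
    | some (.pair _ v) => some v
    | _ => none
  | .add a b =>
    match pureVal env a, pureVal env b with
    | some (.num x), some (.num y) => some (.num (x + y))
    | _, _ => none
  | .sub a b =>
    match pureVal env a, pureVal env b with
    | some (.num x), some (.num y) => some (.num (x - y))
    | _, _ => none
  | .floor a =>
    match pureVal env a with
    | some (.num x) => some (.num (⌊x⌋ : ℝ))
    | _ => none
  | _ => none

/-- The number of steps of an expression without branches, definitions and calls. -/
def pureCost : Expr → ℕ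
  | .pair a b => pureCost a + pureCost b + 1
  | .fst a => pureCost a + 1
  | .snd a => pureCost a + 1
  | .add a b => pureCost a + pureCost b + 1
  | .sub a b => pureCost a + pureCost b + 1
  | .floor a => pureCost a + 1
  | _ => 1

theorem eval_of_pureVal {s : D.State} (h : pureVal env e = some v) :
    Eval F D env e s v s (pureCost e) := by
  induction e generalizing v with
  | var i => exact .var h
  | nil => cases h; exact .nil
  | int z => cases h; exact .int
  | pair a b iha ihb =>
    simp only [pureVal] at h
    split at h
    · next ha hb => cases h; exact .pair (iha ha) (ihb hb)
    · cases h
  | fst a iha =>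
    simp only [pureVal] at h
    split at h
    · next ha => cases h; exact .fst (iha ha)
    · cases h
  | snd a iha =>
    simp only [pureVal] at h
    split at h
    · next ha => cases h; exact .snd (iha ha)
    · cases h
  | add a b iha ihb =>
    simp only [pureVal] at h
    split at h
    · next ha hb => cases h; exact .add (iha ha) (ihb hb)
    · cases h
  | sub a b iha ihb =>
    simp only [pureVal] at h
    split at h
    · next ha hb => cases h; exact .sub (iha ha) (ihb hb)
    · cases h
  | floor a iha =>
    simp only [pureVal] at h
    split at h
    · next ha => cases h; exact .floor (iha ha)
    · cases h
  | _ => cases h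

/-- Straight-line code is thus evaluated by computation: `.pure rfl` discharges it wherever the
environment is explicit. -/
theorem Ev.pure (h : pureVal env e = some v) : Ev F D env e ops v ops (pureCost e) :=
  ⟨_, eval_of_pureVal h, le_rfl⟩

theorem Ev.pair (ha : Ev F D env a ops u ops₁ c₁) (hb : Ev F D env b ops₁ v ops₂ c₂) :
    Ev F D env (.pair a b) ops (.pair u v) ops₂ (c₁ + c₂ + 1) := by
  obtain ⟨t₁, ha, h₁⟩ := ha
  obtain ⟨t₂, hb, h₂⟩ := hb
  exact ⟨_, .pair ha hb, by omega⟩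

theorem Ev.bind (ha : Ev F D env a ops u ops₁ c₁) (hb : Ev F D (u :: env) b ops₁ v ops₂ c₂) :
    Ev F D env (.bind a b) ops v ops₂ (c₁ + c₂ + 1) := by
  obtain ⟨t₁, ha, h₁⟩ := ha
  obtain ⟨t₂, hb, h₂⟩ := hb
  exact ⟨_, .bind ha hb, by omega⟩

theorem Ev.call {f : ℕ} (ha : Ev F D env a ops u ops₁ c₁) (hb : Fn F D f u ops₁ v ops₂ c₂) :
    Ev F D env (.call f a) ops v ops₂ (c₁ + c₂ + 1) := by
  obtain ⟨t₁, ha, h₁⟩ := ha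
  obtain ⟨body, hf, t₂, hb, h₂⟩ := hb
  exact ⟨_, .call hf ha hb, by omega⟩

theorem Ev.ifNil_nil {d : Expr} (hc : Ev F D env d ops .nil ops₁ c₁)
    (ha : Ev F D env a ops₁ v ops₂ c₂) :
    Ev F D env (.ifNil d a b) ops v ops₂ (c₁ + c₂ + 1) := by
  obtain ⟨t₁, hc, h₁⟩ := hc
  obtain ⟨t₂, ha, h₂⟩ := ha
  exact ⟨_, .ifNil_nil hc ha, by omega⟩

theorem Ev.ifNil_pair {d : Expr} {u₁ u₂ : Val} (hc : Ev F D env d ops (.pair u₁ u₂) ops₁ c₁)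
    (hb : Ev F D env b ops₁ v ops₂ c₂) :
    Ev F D env (.ifNil d a b) ops v ops₂ (c₁ + c₂ + 1) := by
  obtain ⟨t₁, hc, h₁⟩ := hc
  obtain ⟨t₂, hb, h₂⟩ := hb
  exact ⟨_, .ifNil_not hc (by simp) hb, by omega⟩

theorem Ev.ifLt_lt {d₁ d₂ : Expr} {x y : ℝ} (hx : Ev F D env d₁ ops (.num x) ops₁ c₁)
    (hy : Ev F D env d₂ ops₁ (.num y) ops₂ c₂) (hxy : x < y)
    (ha : Ev F D env a ops₂ v ops₃ c₃) :
    Ev F D env (.ifLt d₁ d₂ a b) ops v ops₃ (c₁ + c₂ + c₃ + 1) := by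
  obtain ⟨t₁, hx, h₁⟩ := hx
  obtain ⟨t₂, hy, h₂⟩ := hy
  obtain ⟨t₃, ha, h₃⟩ := ha
  exact ⟨_, .ifLt_lt hx hy hxy ha, by omega⟩

theorem Ev.ifLt_not {d₁ d₂ : Expr} {x y : ℝ} (hx : Ev F D env d₁ ops (.num x) ops₁ c₁)
    (hy : Ev F D env d₂ ops₁ (.num y) ops₂ c₂) (hxy : y ≤ x)
    (hb : Ev F D env b ops₂ v ops₃ c₃) :
    Ev F D env (.ifLt d₁ d₂ a b) ops v ops₃ (c₁ + c₂ + c₃ + 1) := by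
  obtain ⟨t₁, hx, h₁⟩ := hx
  obtain ⟨t₂, hy, h₂⟩ := hy
  obtain ⟨t₃, hb, h₃⟩ := hb
  exact ⟨_, .ifLt_not hx hy hxy hb, by omega⟩

theorem Ev.set {i : Fin W.length} (ha : Ev F D env a ops (.num (((i : ℕ) : ℝ) + 1)) ops₁ c) :
    Ev F D env (.set a) ops .nil (ops₁ ++ [.set i]) (c + 1) := by
  obtain ⟨t, ha, h⟩ := ha
  refine ⟨t + D.time (D.stateAfter ops₁) (.set i) + 1, ?_, ?_⟩
  · rw [D.stateAfter_concat]
    exact .set ha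
  · rw [D.timeFrom_concat]
    omega

theorem Ev.undo : Ev F D env .undo ops .nil (ops ++ [.undo]) 1 := by
  refine ⟨D.time (D.stateAfter ops) .undo + 1, ?_, ?_⟩
  · rw [D.stateAfter_concat]
    exact .undo
  · rw [D.timeFrom_concat]
    omega

theorem Ev.cost :
    Ev F D env .cost ops (.num (D.answer (D.stateAfter ops))) (ops ++ [.cost]) 1 := by
  refine ⟨D.time (D.stateAfter ops) .cost + 1, ?_, ?_⟩
  · rw [D.stateAfter_concat]
    exact .cost
  · rw [D.timeFrom_concat]
    omega

end Evaluation

/-! ## The program -/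

section Code

/-- The items `(⌈w⌉ - w, i), …` for `(i, W)`. -/
abbrev itemsBody : Expr :=
  .ifNil (.snd (.var 0)) .nil
    (.pair
      (.pair (.sub (.sub (.int 0) (.floor (.sub (.int 0) (.fst (.snd (.var 0))))))
        (.fst (.snd (.var 0)))) (.fst (.var 0)))
      (.call 0 (.pair (.add (.fst (.var 0)) (.int 1)) (.snd (.snd (.var 0))))))

/-- The length of a list. -/
abbrev lengthBody : Expr :=
  .ifNil (.var 0) (.int 0) (.bind (.call 1 (.snd (.var 0))) (.add (.var 0) (.int 1)))

/-- The items of `L` with key less than `p`, for `(p, L)`. -/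
abbrev belowBody : Expr :=
  .ifNil (.snd (.var 0)) .nil
    (.bind (.call 2 (.pair (.fst (.var 0)) (.snd (.snd (.var 0)))))
      (.ifLt (.fst (.fst (.snd (.var 1)))) (.fst (.var 1))
        (.pair (.fst (.snd (.var 1))) (.var 0)) (.var 0)))

/-- The items of `L` with key `p`, for `(p, L)`. -/
abbrev equalBody : Expr :=
  .ifNil (.snd (.var 0)) .nil
    (.bind (.call 3 (.pair (.fst (.var 0)) (.snd (.snd (.var 0)))))
      (.ifLt (.fst (.fst (.snd (.var 1)))) (.fst (.var 1)) (.var 0)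
        (.ifLt (.fst (.var 1)) (.fst (.fst (.snd (.var 1)))) (.var 0)
          (.pair (.fst (.snd (.var 1))) (.var 0)))))

/-- The items of `L` with key greater than `p`, for `(p, L)`. -/
abbrev aboveBody : Expr :=
  .ifNil (.snd (.var 0)) .nil
    (.bind (.call 4 (.pair (.fst (.var 0)) (.snd (.snd (.var 0)))))
      (.ifLt (.fst (.var 1)) (.fst (.fst (.snd (.var 1))))
        (.pair (.fst (.snd (.var 1))) (.var 0)) (.var 0)))

/-- The medians of consecutive triples of items. -/
abbrev thirdsBody : Expr :=
  .ifNil (.var 0) .nil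
    (.ifNil (.snd (.var 0)) .nil
      (.ifNil (.snd (.snd (.var 0))) .nil
        (.pair (.call 6 (.var 0)) (.call 5 (.snd (.snd (.snd (.var 0))))))))

/-- The median of the first three items of a list. -/
abbrev medianBody : Expr :=
  .bind (.fst (.var 0)) (.bind (.fst (.snd (.var 1))) (.bind (.fst (.snd (.snd (.var 2))))
    (.ifLt (.fst (.var 2)) (.fst (.var 1))
      (.ifLt (.fst (.var 1)) (.fst (.var 0)) (.var 1)
        (.ifLt (.fst (.var 2)) (.fst (.var 0)) (.var 0) (.var 2)))
      (.ifLt (.fst (.var 2)) (.fst (.var 0)) (.var 2)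
        (.ifLt (.fst (.var 1)) (.fst (.var 0)) (.var 0) (.var 1))))))

/-- An approximate median of the keys of a nonempty list of items. -/
abbrev pivotBody : Expr :=
  .bind (.call 5 (.call 5 (.var 0)))
    (.ifNil (.var 0) (.fst (.fst (.var 1))) (.call 8 (.pair (.var 0) (.int 0))))

/-- For `(L, δ)`, a key of `L` that would be a median if there were `δ` more small items. -/
abbrev selectBody : Expr :=
  .bind (.call 7 (.fst (.var 0)))
    (.bind (.call 2 (.pair (.var 0) (.fst (.var 1))))
      (.bind (.call 4 (.pair (.var 1) (.fst (.var 2))))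
        (.bind (.call 1 (.var 1))
          (.bind (.call 1 (.var 1))
            (.bind (.call 1 (.call 3 (.pair (.var 4) (.fst (.var 5)))))
              (.ifLt (.add (.var 1) (.var 0)) (.add (.snd (.var 6)) (.var 2))
                (.call 8 (.pair (.var 4) (.sub (.snd (.var 6)) (.add (.var 1) (.var 0)))))
                (.ifLt (.add (.add (.snd (.var 6)) (.var 2)) (.var 0)) (.var 1)
                  (.call 8 (.pair (.var 3) (.add (.add (.snd (.var 6)) (.var 2)) (.var 0))))
                  (.var 5))))))))

/-- Calls `set` for all items. -/
abbrev setAllBody : Expr :=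
  .ifNil (.var 0) .nil (.bind (.set (.snd (.fst (.var 0)))) (.call 9 (.snd (.var 1))))

/-- Calls `undo` once for each item. -/
abbrev undoAllBody : Expr :=
  .ifNil (.var 0) .nil (.bind .undo (.call 10 (.snd (.var 1))))

/-- For `(L, m)`, the largest key `θ` of `L` such that the cost is less than `m` when the items
with keys at least `θ` have been set. -/
abbrev searchBody : Expr :=
  .bind (.call 7 (.fst (.var 0)))
    (.bind (.call 4 (.pair (.var 0) (.fst (.var 1))))
      (.bind (.call 9 (.var 0))
        (.ifLt .cost (.snd (.var 3))
          (.bind (.call 10 (.var 1)) (.call 11 (.pair (.var 2) (.snd (.var 4)))))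
          (.bind (.call 3 (.pair (.var 2) (.fst (.var 3))))
            (.bind (.call 9 (.var 0))
              (.ifLt .cost (.snd (.var 5)) (.var 4)
                (.call 11 (.pair (.call 2 (.pair (.var 4) (.fst (.var 5))))
                  (.snd (.var 5))))))))))

/-- Adds a tree to a stack of shallower trees or trees of the same depth, for `(S, (b, t))`. -/
abbrev addBody : Expr :=
  .ifNil (.fst (.var 0)) (.pair (.snd (.var 0)) .nil)
    (.ifLt (.fst (.fst (.fst (.var 0)))) (.fst (.snd (.var 0)))
      (.pair (.snd (.var 0)) (.fst (.var 0)))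
      (.call 12 (.pair (.snd (.fst (.var 0)))
        (.pair (.sub (.fst (.snd (.var 0))) (.int 1))
          (.pair (.snd (.fst (.fst (.var 0)))) (.snd (.snd (.var 0))))))))

abbrev addTwiceExpr : Expr :=
  .call 12 (.pair
    (.call 12 (.pair (.fst (.var 0))
      (.pair (.fst (.snd (.var 0))) (.fst (.snd (.snd (.var 0)))))))
    (.pair (.fst (.snd (.var 0))) (.snd (.snd (.snd (.var 0))))))

/-- Merges the trees that are deeper than `b`, for `(S, (b, (acc, t)))`. -/
abbrev collapseBody : Expr :=
  .ifNil (.fst (.var 0)) addTwiceExpr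
    (.ifLt (.fst (.snd (.var 0))) (.fst (.fst (.fst (.var 0))))
      (.call 13 (.pair (.snd (.fst (.var 0)))
        (.pair (.fst (.snd (.var 0)))
          (.pair (.pair (.snd (.fst (.fst (.var 0)))) (.fst (.snd (.snd (.var 0)))))
            (.snd (.snd (.snd (.var 0))))))))
      addTwiceExpr)

/-- Inserts a tree at depth `b`, for `(S, (b, t))`. -/
abbrev insertBody : Expr :=
  .ifNil (.fst (.var 0)) (.call 12 (.var 0))
    (.ifLt (.fst (.snd (.var 0))) (.fst (.fst (.fst (.var 0))))
      (.call 13 (.pair (.snd (.fst (.var 0)))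
        (.pair (.fst (.snd (.var 0)))
          (.pair (.snd (.fst (.fst (.var 0)))) (.snd (.snd (.var 0)))))))
      (.call 12 (.var 0)))

/-- Merges all trees, for `(S, acc)`. -/
abbrev finishBody : Expr :=
  .ifNil (.fst (.var 0)) (.snd (.var 0))
    (.call 15 (.pair (.snd (.fst (.var 0)))
      (.pair (.snd (.fst (.fst (.var 0)))) (.snd (.var 0)))))

/-- Builds the tree, for `(W, (c, S))`. -/
abbrev buildBody : Expr :=
  .ifNil (.fst (.var 0))
    (.call 15 (.pair (.snd (.snd (.snd (.var 0)))) (.snd (.fst (.snd (.snd (.var 0)))))))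
    (.call 16 (.pair (.snd (.fst (.var 0)))
      (.pair (.fst (.snd (.var 0)))
        (.call 14 (.pair (.snd (.snd (.var 0)))
          (.pair (.floor (.sub (.fst (.snd (.var 0))) (.fst (.fst (.var 0))))) (.int 0)))))))

/-- With `m` the initial cost and `θ` the threshold, the tree is built for the target cost `m - θ`,
from an empty stack. -/
abbrev mainBody : Expr :=
  .bind (.call 0 (.pair (.int 1) (.var 0)))
    (.bind .cost
      (.bind (.call 11 (.pair (.var 1) (.var 0)))
        (.call 16 (.pair (.var 3) (.pair (.sub (.var 1) (.var 0)) .nil)))))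

/-- The order matters: the number in each `.call` is a position in this list. -/
def code : List Expr :=
  [itemsBody, lengthBody, belowBody, equalBody, aboveBody, thirdsBody, medianBody, pivotBody,
    selectBody, setAllBody, undoAllBody, searchBody, addBody, collapseBody, insertBody, finishBody,
    buildBody]

end Code


/-! ## Functions on lists of items -/

section Items

variable {W : List ℝ} {D : DataStructure W} {ops : List (Op W.length)}
  {α : Type*} {key idx : α → ℝ}

/-- Items are kept abstract so that the list functions can be specified by `List.filter` on any
type; the program sees only the key and the index. -/
def encItem (key idx : α → ℝ) (x : α) : Val := .pair (.num (key x)) (.num (idx x))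

def encItems (key idx : α → ℝ) : List α → Val
  | [] => .nil
  | x :: L => .pair (encItem key idx x) (encItems key idx L)

theorem fn_length (L : List α) :
    Fn code D 1 (encItems key idx L) ops (.num L.length) ops (10 * L.length + 10) := by
  induction L with
  | nil =>
    exact ⟨_, rfl, (Ev.ifNil_nil (.pure rfl) (.pure rfl)).cast (by simp) (by simp [pureCost])⟩
  | cons x L ih =>
    exact ⟨_, rfl, (Ev.ifNil_pair (.pure rfl) (.bind (.call (.pure rfl) ih) (.pure rfl))).cast
      (by simp) (by simp [pureCost]; omega)⟩

theorem fn_below (p : ℝ) (L : List α) :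
    Fn code D 2 (.pair (.num p) (encItems key idx L)) ops
      (encItems key idx (L.filter (fun x => key x < p))) ops (40 * L.length + 10) := by
  induction L with
  | nil => exact ⟨_, rfl, (Ev.ifNil_nil (.pure rfl) (.pure rfl)).mono (by simp [pureCost])⟩
  | cons x L ih =>
    rcases lt_or_ge (key x) p with h | h
    · exact ⟨_, rfl, (Ev.ifNil_pair (.pure rfl) (.bind (.call (.pure rfl) ih)
        (.ifLt_lt (.pure rfl) (.pure rfl) h (.pure rfl)))).cast
        (by simp [h, encItems]) (by simp [pureCost]; omega)⟩
    · exact ⟨_, rfl, (Ev.ifNil_pair (.pure rfl) (.bind (.call (.pure rfl) ih)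
        (.ifLt_not (.pure rfl) (.pure rfl) h (.pure rfl)))).cast
        (by simp [h.not_gt]) (by simp [pureCost]; omega)⟩

theorem fn_above (p : ℝ) (L : List α) :
    Fn code D 4 (.pair (.num p) (encItems key idx L)) ops
      (encItems key idx (L.filter (fun x => p < key x))) ops (40 * L.length + 10) := by
  induction L with
  | nil => exact ⟨_, rfl, (Ev.ifNil_nil (.pure rfl) (.pure rfl)).mono (by simp [pureCost])⟩
  | cons x L ih =>
    rcases lt_or_ge p (key x) with h | h
    · exact ⟨_, rfl, (Ev.ifNil_pair (.pure rfl) (.bind (.call (.pure rfl) ih)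
        (.ifLt_lt (.pure rfl) (.pure rfl) h (.pure rfl)))).cast
        (by simp [h, encItems]) (by simp [pureCost]; omega)⟩
    · exact ⟨_, rfl, (Ev.ifNil_pair (.pure rfl) (.bind (.call (.pure rfl) ih)
        (.ifLt_not (.pure rfl) (.pure rfl) h (.pure rfl)))).cast
        (by simp [h.not_gt]) (by simp [pureCost]; omega)⟩

theorem fn_equal (p : ℝ) (L : List α) :
    Fn code D 3 (.pair (.num p) (encItems key idx L)) ops
      (encItems key idx (L.filter (fun x => key x = p))) ops (50 * L.length + 10) := by
  induction L with
  | nil => exact ⟨_, rfl, (Ev.ifNil_nil (.pure rfl) (.pure rfl)).mono (by simp [pureCost])⟩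
  | cons x L ih =>
    rcases lt_trichotomy (key x) p with h | h | h
    · exact ⟨_, rfl, (Ev.ifNil_pair (.pure rfl) (.bind (.call (.pure rfl) ih)
        (.ifLt_lt (.pure rfl) (.pure rfl) h (.pure rfl)))).cast
        (by simp [h.ne]) (by simp [pureCost]; omega)⟩
    · exact ⟨_, rfl, (Ev.ifNil_pair (.pure rfl) (.bind (.call (.pure rfl) ih)
        (.ifLt_not (.pure rfl) (.pure rfl) h.ge
          (.ifLt_not (.pure rfl) (.pure rfl) h.le (.pure rfl))))).cast
        (by simp [h, encItems]) (by simp [pureCost]; omega)⟩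
    · exact ⟨_, rfl, (Ev.ifNil_pair (.pure rfl) (.bind (.call (.pure rfl) ih)
        (.ifLt_not (.pure rfl) (.pure rfl) h.le
          (.ifLt_lt (.pure rfl) (.pure rfl) h (.pure rfl))))).cast
        (by simp [h.ne']) (by simp [pureCost]; omega)⟩

/-- The item with the median key. -/
noncomputable def median (key : α → ℝ) (a b c : α) : α :=
  if key a < key b then
    if key b < key c then b else if key a < key c then c else a
  else
    if key a < key c then a else if key b < key c then c else b

theorem fn_median (a b c : α) (L : List α) :
    Fn code D 6 (encItems key idx (a :: b :: c :: L)) ops (encItem key idx (median key a b c)) ops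
      50 := by
  -- A common budget of `31` covers all six outcomes of the comparisons.
  refine ⟨_, rfl, Ev.mono (.bind (.pure rfl) (.bind (.pure rfl) (.bind (c₂ := 31) (.pure rfl) ?_)))
    (by simp [pureCost])⟩
  unfold median
  split_ifs with h₁ h₂ h₃ h₃ h₂
  · exact (Ev.ifLt_lt (.pure rfl) (.pure rfl) h₁
      (.ifLt_lt (.pure rfl) (.pure rfl) h₂ (.pure rfl))).mono (by simp [pureCost])
  · exact (Ev.ifLt_lt (.pure rfl) (.pure rfl) h₁
      (.ifLt_not (.pure rfl) (.pure rfl) (not_lt.1 h₂)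
        (.ifLt_lt (.pure rfl) (.pure rfl) h₃ (.pure rfl)))).mono (by simp [pureCost])
  · exact (Ev.ifLt_lt (.pure rfl) (.pure rfl) h₁
      (.ifLt_not (.pure rfl) (.pure rfl) (not_lt.1 h₂)
        (.ifLt_not (.pure rfl) (.pure rfl) (not_lt.1 h₃) (.pure rfl)))).mono (by simp [pureCost])
  · exact (Ev.ifLt_not (.pure rfl) (.pure rfl) (not_lt.1 h₁)
      (.ifLt_lt (.pure rfl) (.pure rfl) h₃ (.pure rfl))).mono (by simp [pureCost])
  · exact (Ev.ifLt_not (.pure rfl) (.pure rfl) (not_lt.1 h₁)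
      (.ifLt_not (.pure rfl) (.pure rfl) (not_lt.1 h₃)
        (.ifLt_lt (.pure rfl) (.pure rfl) h₂ (.pure rfl)))).mono (by simp [pureCost])
  · exact (Ev.ifLt_not (.pure rfl) (.pure rfl) (not_lt.1 h₁)
      (.ifLt_not (.pure rfl) (.pure rfl) (not_lt.1 h₃)
        (.ifLt_not (.pure rfl) (.pure rfl) (not_lt.1 h₂) (.pure rfl)))).mono (by simp [pureCost])

/-- The medians of consecutive triples. -/
noncomputable def thirds (key : α → ℝ) : List α → List α
  | a :: b :: c :: L => median key a b c :: thirds key L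
  | _ => []

theorem length_thirds (L : List α) : (thirds key L).length = L.length / 3 := by
  induction L using thirds.induct with
  | case1 a b c L ih =>
    simp only [thirds, List.length_cons, ih]
    omega
  | case2 L h =>
    rcases L with _ | ⟨a, _ | ⟨b, _ | ⟨c, L⟩⟩⟩
    · simp [thirds]
    · simp [thirds]
    · simp [thirds]
    · exact (h a b c L rfl).elim

theorem median_eq (a b c : α) :
    median key a b c = a ∨ median key a b c = b ∨ median key a b c = c := by
  unfold median
  split_ifs <;> simp

theorem mem_of_mem_thirds {x : α} (L : List α) (h : x ∈ thirds key L) : x ∈ L := by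
  induction L using thirds.induct with
  | case1 a b c L ih =>
    simp only [thirds, List.mem_cons] at h ⊢
    rcases h with rfl | h
    · rcases median_eq (key := key) a b c with h | h | h <;> simp [h]
    · simp [ih h]
  | case2 L h' =>
    rcases L with _ | ⟨a, _ | ⟨b, _ | ⟨c, L⟩⟩⟩
    · simp [thirds] at h
    · simp [thirds] at h
    · simp [thirds] at h
    · exact (h' a b c L rfl).elim

/-- If the median of a triple is at most `p`, so are at least two of its members. -/
theorem countP_le_thirds (p : ℝ) (L : List α) :
    2 * (thirds key L).countP (fun x => key x ≤ p) ≤ L.countP (fun x => key x ≤ p) := by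
  induction L using thirds.induct with
  | case1 a b c L ih =>
    simp only [thirds, List.countP_cons, decide_eq_true_eq]
    have : 2 * (if key (median key a b c) ≤ p then 1 else 0) ≤
        (if key a ≤ p then 1 else 0) + (if key b ≤ p then 1 else 0) +
          (if key c ≤ p then 1 else 0) := by
      unfold median
      split_ifs <;> first | omega | (exfalso; linarith)
    omega
  | case2 L h =>
    rcases L with _ | ⟨a, _ | ⟨b, _ | ⟨c, L⟩⟩⟩
    · simp [thirds]
    · simp [thirds]
    · simp [thirds]
    · exact (h a b c L rfl).elim

theorem countP_ge_thirds (p : ℝ) (L : List α) :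
    2 * (thirds key L).countP (fun x => p ≤ key x) ≤ L.countP (fun x => p ≤ key x) := by
  induction L using thirds.induct with
  | case1 a b c L ih =>
    simp only [thirds, List.countP_cons, decide_eq_true_eq]
    have : 2 * (if p ≤ key (median key a b c) then 1 else 0) ≤
        (if p ≤ key a then 1 else 0) + (if p ≤ key b then 1 else 0) +
          (if p ≤ key c then 1 else 0) := by
      unfold median
      split_ifs <;> first | omega | (exfalso; linarith)
    omega
  | case2 L h =>
    rcases L with _ | ⟨a, _ | ⟨b, _ | ⟨c, L⟩⟩⟩
    · simp [thirds]
    · simp [thirds]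
    · simp [thirds]
    · exact (h a b c L rfl).elim

theorem fn_thirds (L : List α) :
    Fn code D 5 (encItems key idx L) ops (encItems key idx (thirds key L)) ops
      (30 * L.length + 20) := by
  induction L using thirds.induct with
  | case1 a b c L ih =>
    exact ⟨_, rfl, (Ev.ifNil_pair (.pure rfl) (.ifNil_pair (.pure rfl) (.ifNil_pair (.pure rfl)
      (.pair (.call (.pure rfl) (fn_median a b c L)) (.call (.pure rfl) ih))))).mono
      (by simp [pureCost]; omega)⟩
  | case2 L h =>
    rcases L with _ | ⟨a, _ | ⟨b, _ | ⟨c, L⟩⟩⟩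
    · exact ⟨_, rfl, (Ev.ifNil_nil (.pure rfl) (.pure rfl)).mono (by simp [pureCost])⟩
    · exact ⟨_, rfl, (Ev.ifNil_pair (.pure rfl) (.ifNil_nil (.pure rfl) (.pure rfl))).mono
        (by simp [pureCost])⟩
    · exact ⟨_, rfl, (Ev.ifNil_pair (.pure rfl) (.ifNil_pair (.pure rfl)
        (.ifNil_nil (.pure rfl) (.pure rfl)))).mono (by simp [pureCost])⟩
    · exact (h a b c L rfl).elim

end Items


/-! ## Selection of pivots in linear time -/

section Selection

variable {W : List ℝ} {α : Type*} {key idx : α → ℝ}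

theorem length_filter_lt (p : ℝ) (L : List α) :
    (L.filter (fun x => key x < p)).length + L.countP (fun x => p ≤ key x) = L.length := by
  induction L with
  | nil => rfl
  | cons x L ih =>
    rcases lt_or_ge (key x) p with h | h
    · simp [h, h.not_ge]
      omega
    · simp [h, h.not_gt]
      omega

theorem length_filter_gt (p : ℝ) (L : List α) :
    (L.filter (fun x => p < key x)).length + L.countP (fun x => key x ≤ p) = L.length := by
  induction L with
  | nil => rfl
  | cons x L ih =>
    rcases lt_or_ge p (key x) with h | h
    · simp [h, h.not_ge]
      omega
    · simp [h, h.not_gt]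
      omega

theorem length_filters (p : ℝ) (L : List α) :
    (L.filter (fun x => key x < p)).length + (L.filter (fun x => key x = p)).length +
      (L.filter (fun x => p < key x)).length = L.length := by
  induction L with
  | nil => rfl
  | cons x L ih =>
    rcases lt_trichotomy (key x) p with h | h | h
    · simp [h, h.ne, h.le]
      omega
    · simp [h]
      omega
    · simp [h, h.ne', h.le]
      omega

theorem countP_filter_lt {p q : ℝ} (hqp : q < p) (L : List α) :
    (L.filter (fun x => key x < p)).countP (fun x => key x ≤ q) = L.countP (fun x => key x ≤ q) := by
  rw [List.countP_filter]
  refine List.countP_congr fun x _ => ?_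
  simp only [Bool.and_eq_true, decide_eq_true_eq]
  exact ⟨fun h => h.1, fun h => ⟨h, h.trans_lt hqp⟩⟩

theorem countP_filter_gt {p q : ℝ} (hpq : p < q) (L : List α) :
    (L.filter (fun x => p < key x)).countP (fun x => q ≤ key x) = L.countP (fun x => q ≤ key x) := by
  rw [List.countP_filter]
  refine List.countP_congr fun x _ => ?_
  simp only [Bool.and_eq_true, decide_eq_true_eq]
  exact ⟨fun h => h.1, fun h => ⟨h, hpq.trans_le h⟩⟩

theorem filter_filter_lt {p q : ℝ} (hqp : q < p) (L : List α) :
    (L.filter (fun x => key x < p)).filter (fun x => key x < q) =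
      L.filter (fun x => key x < q) := by
  rw [List.filter_filter]
  refine List.filter_congr fun x _ => ?_
  simp only [Bool.and_eq_left_iff_imp, decide_eq_true_eq]
  exact fun h => h.trans hqp

theorem filter_filter_gt {p q : ℝ} (hpq : p < q) (L : List α) :
    (L.filter (fun x => p < key x)).filter (fun x => q < key x) =
      L.filter (fun x => q < key x) := by
  rw [List.filter_filter]
  refine List.filter_congr fun x _ => ?_
  simp only [Bool.and_eq_left_iff_imp, decide_eq_true_eq]
  exact fun h => hpq.trans h

/-- `p` is a key of `L` that would be a median if there were `δ` more small items. -/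
def IsShiftedMedian (key : α → ℝ) (L : List α) (δ : ℤ) (p : ℝ) : Prop :=
  (∃ x ∈ L, key x = p) ∧
    δ + (L.filter (fun x => key x < p)).length ≤ L.countP (fun x => p ≤ key x) ∧
    ((L.filter (fun x => p < key x)).length : ℤ) ≤ δ + L.countP (fun x => key x ≤ p)

/-- `p` is an approximate median of the keys of `L`. -/
def IsPivot (key : α → ℝ) (L : List α) (p : ℝ) : Prop :=
  (∃ x ∈ L, key x = p) ∧ 2 * (L.length / 9) ≤ L.countP (fun x => p ≤ key x) ∧
    2 * (L.length / 9) ≤ L.countP (fun x => key x ≤ p)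

theorem IsPivot.length_lt {L : List α} {p : ℝ} (h : IsPivot key L p) :
    (L.filter (fun x => key x < p)).length < L.length ∧
      (L.filter (fun x => key x < p)).length + 2 * (L.length / 9) ≤ L.length := by
  have h₁ := length_filter_lt (key := key) p L
  obtain ⟨⟨x, hx, hxp⟩, h₂, -⟩ := h
  have : 0 < L.countP (fun x => p ≤ key x) :=
    List.countP_pos_iff.2 ⟨x, hx, by simp [hxp]⟩
  omega

theorem IsPivot.length_gt {L : List α} {p : ℝ} (h : IsPivot key L p) :
    (L.filter (fun x => p < key x)).length < L.length ∧
      (L.filter (fun x => p < key x)).length + 2 * (L.length / 9) ≤ L.length := by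
  have h₁ := length_filter_gt (key := key) p L
  obtain ⟨⟨x, hx, hxp⟩, -, h₂⟩ := h
  have : 0 < L.countP (fun x => key x ≤ p) :=
    List.countP_pos_iff.2 ⟨x, hx, by simp [hxp]⟩
  omega

/-- At least half of the `⌊n/9⌋` iterated medians lie on each side of `p` (ties included), and each
of the two levels doubles the count, which gives `2⌊n/9⌋` items of `L` on each side. -/
theorem isPivot_of_thirds {L : List α} {p : ℝ}
    (h : IsShiftedMedian key (thirds key (thirds key L)) 0 p) : IsPivot key L p := by
  obtain ⟨⟨x, hx, hxp⟩, h₁, h₂⟩ := h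
  have h₃ := length_filter_lt (key := key) p (thirds key (thirds key L))
  have h₄ := length_filter_gt (key := key) p (thirds key (thirds key L))
  have h₅ := countP_le_thirds (key := key) p (thirds key L)
  have h₆ := countP_le_thirds (key := key) p L
  have h₇ := countP_ge_thirds (key := key) p (thirds key L)
  have h₈ := countP_ge_thirds (key := key) p L
  rw [length_thirds, length_thirds] at h₃ h₄
  exact ⟨⟨x, mem_of_mem_thirds _ (mem_of_mem_thirds _ hx), hxp⟩, by omega, by omega⟩

/-- Selection in `L` takes linear time. -/
def Selects (D : DataStructure W) (key idx : α → ℝ) (L : List α) : Prop :=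
  ∀ δ : ℤ, |δ| ≤ L.length → ∃ p, IsShiftedMedian key L δ p ∧ ∀ ops,
    Fn code D 8 (.pair (encItems key idx L) (.num δ)) ops (.num p) ops (8500 * L.length)

theorem exists_pivot_of_selects (D : DataStructure W) {L : List α} (hL : L ≠ [])
    (h : thirds key (thirds key L) ≠ [] → Selects D key idx (thirds key (thirds key L))) :
    ∃ p, IsPivot key L p ∧ ∀ ops,
      Fn code D 7 (encItems key idx L) ops (.num p) ops
        (8500 * (L.length / 9) + 50 * L.length + 100) := by
  have hlen : (thirds key (thirds key L)).length = L.length / 9 := by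
    rw [length_thirds, length_thirds]
    omega
  have hlen' := length_thirds (key := key) L
  obtain ⟨x, L', rfl⟩ := List.exists_cons_of_ne_nil hL
  cases hM : thirds key (thirds key (x :: L')) with
  | nil =>
    rw [hM, List.length_nil] at hlen
    -- Here `L` has fewer than nine items, so `2 * (L.length / 9) = 0` and any key is a pivot.
    refine ⟨key x, ⟨⟨x, by simp, rfl⟩, by omega, by omega⟩, fun ops => ⟨_, rfl,
      Ev.mono (.bind (.call (.call (.pure rfl) (fn_thirds _)) (fn_thirds _))
        (c₂ := 7) ?_) ?_⟩⟩
    · rw [hM]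
      exact Ev.mono (.ifNil_nil (.pure rfl) (.pure rfl)) (by simp [pureCost])
    · simp only [pureCost]
      omega
  | cons y M =>
    rw [hM] at h hlen
    obtain ⟨p, hp, hfn⟩ := h (by simp) 0 (by rw [abs_zero]; positivity)
    refine ⟨p, isPivot_of_thirds (hM ▸ hp), fun ops => ⟨_, rfl,
      Ev.mono (.bind (.call (.call (.pure rfl) (fn_thirds _)) (fn_thirds _))
        (c₂ := 8500 * ((x :: L').length / 9) + 7) ?_) ?_⟩⟩
    · rw [hM]
      exact Ev.mono (.ifNil_pair (.pure rfl) (.call (.pure rfl) (hfn ops)))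
        (by simp only [pureCost]; omega)
    · simp only [pureCost]
      omega

/-- The recursion is `T(n) ≤ T(n/9) + T(7n/9) + O(n)` up to rounding, and `1/9 + 7/9 < 1`. Medians
of triples are taken twice because once would give `1/3 + 2/3 = 1`, which is not linear. The offset
`δ` replaces a rank: discarded items turn into virtual small or large ones. -/
theorem selects (D : DataStructure W) (L : List α) (hL : L ≠ []) : Selects D key idx L := by
  induction hn : L.length using Nat.strong_induction_on generalizing L with
  | _ n ih =>
  subst hn
  have hpos := List.length_pos_iff.2 hL
  have hlen : (thirds key (thirds key L)).length = L.length / 9 := by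
    rw [length_thirds, length_thirds]
    omega
  obtain ⟨p, hp, hfn⟩ := exists_pivot_of_selects (idx := idx) D hL
    fun h => ih _ (by omega) _ h rfl
  intro δ hδ
  rw [abs_le] at hδ
  have hB := hp.length_lt
  have hG := hp.length_gt
  have hsum := length_filters (key := key) p L
  have hB' := length_filter_lt (key := key) p L
  have hG' := length_filter_gt (key := key) p L
  set B := L.filter (fun x => key x < p) with hBdef
  set E := L.filter (fun x => key x = p) with hEdef
  set G := L.filter (fun x => p < key x) with hGdef
  -- All cases share the same bindings. A recursive call drops at least `max 1 (2 * (L.length / 9))`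
  -- items; the part of `8500 * L.length` so released pays for the pivot and the linear passes.
  have main : ∀ q, (∀ ops, Ev code D
        [.num E.length, .num G.length, .num B.length, encItems key idx G, encItems key idx B,
          .num p, .pair (encItems key idx L) (.num δ)]
        (.ifLt (.add (.var 1) (.var 0)) (.add (.snd (.var 6)) (.var 2))
          (.call 8 (.pair (.var 4) (.sub (.snd (.var 6)) (.add (.var 1) (.var 0)))))
          (.ifLt (.add (.add (.snd (.var 6)) (.var 2)) (.var 0)) (.var 1)
            (.call 8 (.pair (.var 3) (.add (.add (.snd (.var 6)) (.var 2)) (.var 0))))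
            (.var 5))) ops (.num q) ops (8500 * (L.length - max 1 (2 * (L.length / 9))) + 40)) →
      ∀ ops, Fn code D 8 (.pair (encItems key idx L) (.num δ)) ops (.num q) ops
        (8500 * L.length) := by
    intro q hq ops
    refine ⟨_, rfl, Ev.mono
      (.bind (.call (.pure rfl) (hfn ops))
      (.bind (.call (.pure rfl) (fn_below p L))
      (.bind (.call (.pure rfl) (fn_above p L))
      (.bind (.call (.pure rfl) (fn_length B))
      (.bind (.call (.pure rfl) (fn_length G))
      (.bind (.call (.call (.pure rfl) (fn_equal p L)) (fn_length E)) (hq ops))))))) ?_⟩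
    simp only [pureCost]
    omega
  by_cases h₁ : (G.length : ℤ) + E.length < δ + B.length
  · have hBne : B ≠ [] := by
      intro h
      rw [h, List.length_nil] at h₁ hsum
      omega
    -- The discarded items are all larger than those of `B`, so they are subtracted from `δ`. The
    -- new offset is at least `-B.length` by `h₁` and at most `B.length` by `hδ`.
    obtain ⟨q, ⟨⟨x, hx, hxq⟩, hq₁, hq₂⟩, hq⟩ :=
      ih _ hB.1 B hBne rfl (δ - (G.length + E.length)) (by rw [abs_le]; omega)
    have hqp : q < p := by
      rw [hBdef, List.mem_filter] at hx
      rw [← hxq]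
      simpa using hx.2
    have e₁ : B.filter (fun x => key x < q) = L.filter (fun x => key x < q) :=
      filter_filter_lt hqp L
    have e₂ : B.countP (fun x => key x ≤ q) = L.countP (fun x => key x ≤ q) :=
      countP_filter_lt hqp L
    have e₃ := length_filter_lt (key := key) q L
    have e₄ := length_filter_gt (key := key) q L
    have e₅ := length_filter_lt (key := key) q B
    have e₆ := length_filter_gt (key := key) q B
    rw [e₁] at hq₁ e₅
    rw [e₂] at hq₂ e₆
    refine ⟨q, ⟨⟨x, (List.mem_filter.1 hx).1, hxq⟩, by omega, by omega⟩, main q fun ops => ?_⟩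
    have hq' := hq ops
    push_cast at hq'
    exact (Ev.ifLt_lt (.pure rfl) (.pure rfl) (by exact_mod_cast h₁)
      (.call (.pure rfl) hq')).mono (by simp only [pureCost]; omega)
  · by_cases h₂ : δ + B.length + E.length < G.length
    · have hGne : G ≠ [] := by
        intro h
        rw [h, List.length_nil] at h₂ hsum
        omega
      -- Symmetrically, the discarded items of `B` and `E` count as virtual small items.
      obtain ⟨q, ⟨⟨x, hx, hxq⟩, hq₁, hq₂⟩, hq⟩ :=
        ih _ hG.1 G hGne rfl (δ + B.length + E.length) (by rw [abs_le]; omega)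
      have hpq : p < q := by
        rw [hGdef, List.mem_filter] at hx
        rw [← hxq]
        simpa using hx.2
      have e₁ : G.filter (fun x => q < key x) = L.filter (fun x => q < key x) :=
        filter_filter_gt hpq L
      have e₂ : G.countP (fun x => q ≤ key x) = L.countP (fun x => q ≤ key x) :=
        countP_filter_gt hpq L
      have e₃ := length_filter_lt (key := key) q L
      have e₄ := length_filter_gt (key := key) q L
      have e₅ := length_filter_lt (key := key) q G
      have e₆ := length_filter_gt (key := key) q G
      rw [e₁] at hq₂ e₆
      rw [e₂] at hq₁ e₅
      refine ⟨q, ⟨⟨x, (List.mem_filter.1 hx).1, hxq⟩, by omega, by omega⟩, main q fun ops => ?_⟩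
      have hq' := hq ops
      push_cast at hq'
      exact (Ev.ifLt_not (.pure rfl) (.pure rfl) (by exact_mod_cast not_lt.1 h₁)
        (.ifLt_lt (.pure rfl) (.pure rfl) (by exact_mod_cast h₂)
          (.call (.pure rfl) hq'))).mono (by simp only [pureCost]; omega)
    · have h₃ : δ + (B.length : ℤ) ≤ L.countP (fun x => p ≤ key x) := by omega
      have h₄ : (G.length : ℤ) ≤ δ + L.countP (fun x => key x ≤ p) := by omega
      refine ⟨p, ⟨hp.1, h₃, h₄⟩, main p fun ops => ?_⟩
      exact (Ev.ifLt_not (.pure rfl) (.pure rfl) (by exact_mod_cast not_lt.1 h₁)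
        (.ifLt_not (.pure rfl) (.pure rfl) (by exact_mod_cast not_lt.1 h₂)
          (.pure rfl))).mono (by simp only [pureCost]; omega)

theorem exists_pivot (D : DataStructure W) {L : List α} (hL : L ≠ []) :
    ∃ p, IsPivot key L p ∧ ∀ ops,
      Fn code D 7 (encItems key idx L) ops (.num p) ops (1200 * L.length) := by
  obtain ⟨p, hp, hfn⟩ := exists_pivot_of_selects (idx := idx) D hL
    fun h => selects D (thirds key (thirds key L)) h
  have := List.length_pos_iff.2 hL
  exact ⟨p, hp, fun ops => (hfn ops).cast rfl (by omega)⟩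

end Selection


/-! ## The search for the threshold -/

section Search

variable {W : List ℝ} {D : DataStructure W} {key : Fin W.length → ℝ}

theorem effects_concat {n : ℕ} (ops : List (Op n)) (op : Op n) :
    effects (ops ++ [op]) = (effects ops).bind fun st => op.effect st := by
  unfold effects
  rw [List.foldlM_append]
  cases ops.foldlM Op.effect [] <;> simp

/-- The position of a weight, as a number. -/
def position (i : Fin W.length) : ℝ := ((i : ℕ) : ℝ) + 1

theorem fn_setAll (L st : List (Fin W.length)) (ops : List (Op W.length))
    (h : effects ops = some st) :
    ∃ ops', effects ops' = some (L.reverse ++ st) ∧ ops'.length = ops.length + L.length ∧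
      Fn code D 9 (encItems key position L) ops .nil ops' (20 * L.length + 10) := by
  induction L generalizing st ops with
  | nil => exact ⟨ops, h, rfl, _, rfl,
      (Ev.ifNil_nil (.pure rfl) (.pure rfl)).mono (by simp [pureCost])⟩
  | cons i L ih =>
    obtain ⟨ops', h₁, h₂, h₃⟩ := ih (i :: st) (ops ++ [.set i])
      (by rw [effects_concat, h]; rfl)
    refine ⟨ops', by simp [h₁], by simp [h₂]; omega, _, rfl, ?_⟩
    exact (Ev.ifNil_pair (.pure rfl) (.bind (.set (.pure rfl)) (.call (.pure rfl) h₃))).mono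
      (by simp only [pureCost, List.length_cons]; omega)

theorem fn_undoAll (L S st : List (Fin W.length)) (ops : List (Op W.length))
    (h : effects ops = some (S ++ st)) (hS : S.length = L.length) :
    ∃ ops', effects ops' = some st ∧ ops'.length = ops.length + L.length ∧
      Fn code D 10 (encItems key position L) ops .nil ops' (20 * L.length + 10) := by
  induction L generalizing S ops with
  | nil =>
    obtain rfl := List.length_eq_zero_iff.1 hS
    exact ⟨ops, h, rfl, _, rfl,
      (Ev.ifNil_nil (.pure rfl) (.pure rfl)).mono (by simp [pureCost])⟩
  | cons i L ih =>
    obtain ⟨j, S, rfl⟩ := List.exists_cons_of_length_eq_add_one hS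
    obtain ⟨ops', h₁, h₂, h₃⟩ := ih S (ops ++ [.undo])
      (by rw [effects_concat, h]; rfl) (by simpa using hS)
    refine ⟨ops', h₁, by simp [h₂]; omega, _, rfl, ?_⟩
    exact (Ev.ifNil_pair (.pure rfl) (.bind .undo (.call (.pure rfl) h₃))).mono
      (by simp only [pureCost, List.length_cons]; omega)

/-- `Good` stands for "the cost is below `m`". The invariant is that the positions in `st` are set,
that they do not suffice, and that adding all of `L` does; hence the threshold is a key of `L`. A
round issues at most two operations per item of `L`, up to a constant, and the recursion is on a
list smaller by about `2/9`, so the totals are linear. -/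
theorem fn_search {m : ℝ} {Good : List (Fin W.length) → Prop}
    (hmono : ∀ S S' : List (Fin W.length), (∀ i ∈ S, i ∈ S') → Good S → Good S')
    (hcost : ∀ ops st, effects ops = some st → (D.answer (D.stateAfter ops) < m ↔ Good st))
    (L st : List (Fin W.length)) (ops : List (Op W.length)) (h : effects ops = some st)
    (hneg : ¬ Good st) (hpos : Good (L ++ st)) :
    ∃ θ ops', (∃ i ∈ L, key i = θ) ∧ (effects ops').isSome ∧
      ops'.length ≤ ops.length + 70 * L.length ∧
      Fn code D 11 (.pair (encItems key position L) (.num m)) ops (.num θ) ops'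
        (30000 * L.length) ∧
      Good (L.filter (fun i => θ ≤ key i) ++ st) ∧
      ¬ Good (L.filter (fun i => θ < key i) ++ st) := by
  induction hn : L.length using Nat.strong_induction_on generalizing L st ops with
  | _ n ih =>
  subst hn
  have hL : L ≠ [] := by
    rintro rfl
    exact hneg hpos
  have hlen := List.length_pos_iff.2 hL
  obtain ⟨p, hp, hfn⟩ := exists_pivot (key := key) (idx := position) D hL
  have hB := hp.length_lt
  have hG := hp.length_gt
  have hsum := length_filters (key := key) p L
  set B := L.filter (fun i => key i < p) with hBdef
  set E := L.filter (fun i => key i = p) with hEdef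
  set G := L.filter (fun i => p < key i) with hGdef
  obtain ⟨ops₁, e₁, l₁, hset⟩ := fn_setAll (D := D) (key := key) G st ops h
  have e₂ : effects (ops₁ ++ [.cost]) = some (G.reverse ++ st) := by
    rw [effects_concat, e₁]
    rfl
  by_cases hgG : Good (G.reverse ++ st)
  · obtain ⟨ops₂, e₃, l₂, hundo⟩ :=
      -- The items of `G` suffice, so the threshold lies among their keys; undoing them restores
      -- `st`.
      fn_undoAll (D := D) (key := key) G G.reverse st (ops₁ ++ [.cost]) e₂ (by simp)
    obtain ⟨θ, ops₃, ⟨i, hi, hiθ⟩, e₄, l₃, hrec, g₁, g₂⟩ :=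
      ih _ hG.1 G st ops₂ e₃ hneg (hmono _ _ (by simp) hgG) rfl
    have hpθ : p < θ := by
      rw [hGdef, List.mem_filter] at hi
      rw [← hiθ]
      simpa using hi.2
    refine ⟨θ, ops₃, ⟨i, (List.mem_filter.1 hi).1, hiθ⟩, e₄, ?_, ⟨_, rfl, ?_⟩, ?_, ?_⟩
    · simp only [List.length_append, List.length_singleton] at l₂
      omega
    · refine Ev.mono
        (.bind (.call (.pure rfl) (hfn ops))
        (.bind (.call (.pure rfl) (fn_above p L))
        (.bind (.call (.pure rfl) hset)
        (.ifLt_lt .cost (.pure rfl) ((hcost _ _ e₁).2 hgG)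
          (.bind (.call (.pure rfl) hundo) (.call (.pure rfl) hrec)))))) ?_
      simp only [pureCost]
      omega
    · refine hmono _ _ (fun j => ?_) g₁
      simp only [hGdef, List.mem_append, List.mem_filter, decide_eq_true_eq]
      tauto
    · rwa [hGdef, filter_filter_gt hpθ] at g₂
  · obtain ⟨ops₂, e₃, l₂, hset₂⟩ :=
      fn_setAll (D := D) (key := key) E (G.reverse ++ st) (ops₁ ++ [.cost]) e₂
    have e₄ : effects (ops₂ ++ [.cost]) = some (E.reverse ++ (G.reverse ++ st)) := by
      rw [effects_concat, e₃]
      rfl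
    simp only [List.length_append, List.length_singleton] at l₂
    by_cases hgE : Good (E.reverse ++ (G.reverse ++ st))
    · refine ⟨p, ops₂ ++ [.cost], hp.1, by simp [e₄], ?_, ⟨_, rfl, ?_⟩, ?_, ?_⟩
      · simp only [List.length_append, List.length_singleton]
        omega
      · refine Ev.mono
          (.bind (.call (.pure rfl) (hfn ops))
          (.bind (.call (.pure rfl) (fn_above p L))
          (.bind (.call (.pure rfl) hset)
          (.ifLt_not .cost (.pure rfl) (not_lt.1 ((hcost _ _ e₁).not.2 hgG))
            (.bind (.call (.pure rfl) (fn_equal p L))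
            (.bind (.call (.pure rfl) hset₂)
            (.ifLt_lt .cost (.pure rfl) ((hcost _ _ e₃).2 hgE) (.pure rfl)))))))) ?_
        simp only [pureCost]
        omega
      · refine hmono _ _ (fun j => ?_) hgE
        simp only [hGdef, hEdef, List.mem_append, List.mem_filter, decide_eq_true_eq,
          List.mem_reverse]
        rintro (⟨hj, h⟩ | ⟨hj, h⟩ | h)
        · exact .inl ⟨hj, h.ge⟩
        · exact .inl ⟨hj, h.le⟩
        · exact .inr h
      · exact fun hg => hgG (hmono _ _ (by simp [hGdef]) hg)
    · have hpos' : Good (B ++ (E.reverse ++ (G.reverse ++ st))) := by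
        refine hmono _ _ (fun j => ?_) hpos
        simp only [hGdef, hEdef, hBdef, List.mem_append, List.mem_filter, decide_eq_true_eq,
          List.mem_reverse]
        rcases lt_trichotomy (key j) p with h | h | h <;> tauto
      -- Nothing is undone here: `E` and `G` lie above the threshold, so they stay set and join `st`
      -- for the search in `B`.
      obtain ⟨θ, ops₃, ⟨i, hi, hiθ⟩, e₅, l₃, hrec, g₁, g₂⟩ :=
        ih _ hB.1 B _ (ops₂ ++ [.cost]) e₄ hgE hpos' rfl
      have hθp : θ < p := by
        rw [hBdef, List.mem_filter] at hi
        rw [← hiθ]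
        simpa using hi.2
      simp only [List.length_append, List.length_singleton] at l₃
      refine ⟨θ, ops₃, ⟨i, (List.mem_filter.1 hi).1, hiθ⟩, e₅, ?_, ⟨_, rfl, ?_⟩, ?_, ?_⟩
      · omega
      · refine Ev.mono
          (.bind (.call (.pure rfl) (hfn ops))
          (.bind (.call (.pure rfl) (fn_above p L))
          (.bind (.call (.pure rfl) hset)
          (.ifLt_not .cost (.pure rfl) (not_lt.1 ((hcost _ _ e₁).not.2 hgG))
            (.bind (.call (.pure rfl) (fn_equal p L))
            (.bind (.call (.pure rfl) hset₂)
            (.ifLt_not .cost (.pure rfl) (not_lt.1 ((hcost _ _ e₃).not.2 hgE))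
              (.call (.pair (.call (.pure rfl) (fn_below p L)) (.pure rfl)) hrec)))))))) ?_
        simp only [pureCost]
        omega
      · refine hmono _ _ (fun j => ?_) g₁
        simp only [hGdef, hEdef, hBdef, List.mem_append, List.mem_filter, decide_eq_true_eq,
          List.mem_reverse]
        rintro (⟨⟨hj, -⟩, h⟩ | ⟨hj, h⟩ | ⟨hj, h⟩ | h)
        · exact .inl ⟨hj, h⟩
        · exact .inl ⟨hj, h ▸ hθp.le⟩
        · exact .inl ⟨hj, (hθp.trans h).le⟩
        · exact .inr h
      · refine fun hg => g₂ (hmono _ _ (fun j => ?_) hg)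
        simp only [hGdef, hEdef, hBdef, List.mem_append, List.mem_filter, decide_eq_true_eq,
          List.mem_reverse]
        rintro (⟨hj, h⟩ | h)
        · rcases lt_trichotomy (key j) p with h' | h' | h' <;> tauto
        · exact .inr (.inr (.inr h))

end Search


/-! ## Building a tree whose leaves have bounded depths -/

section Stack

/-- Adds a tree to a stack, with carries, like a binary counter. -/
def add : List (ℤ × Tree) → ℤ → Tree → List (ℤ × Tree)
  | [], b, t => [(b, t)]
  | (d, t₁) :: S, b, t => if d < b then (b, t) :: (d, t₁) :: S else add S (b - 1) (.binary t₁ t)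

/-- Merges the trees that are deeper than `b` into `acc`, and then adds `acc` and `t`. -/
def collapse : List (ℤ × Tree) → ℤ → Tree → Tree → List (ℤ × Tree)
  | [], b, acc, t => add (add [] b acc) b t
  | (d, t₁) :: S, b, acc, t =>
    if b < d then collapse S b (.binary t₁ acc) t else add (add ((d, t₁) :: S) b acc) b t

def insert : List (ℤ × Tree) → ℤ → Tree → List (ℤ × Tree)
  | [], b, t => add [] b t
  | (d, t₁) :: S, b, t => if b < d then collapse S b t₁ t else add ((d, t₁) :: S) b t

/-- Merges all trees of a stack into `acc`. -/
def finish : List (ℤ × Tree) → Tree → Tree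
  | [], acc => acc
  | (_, t) :: S, acc => finish S (.binary t acc)

def finishStack : List (ℤ × Tree) → Tree
  | [] => .leaf
  | (_, t) :: S => finish S t

def insertLeaves (S : List (ℤ × Tree)) (bs : List ℤ) : List (ℤ × Tree) :=
  bs.foldl (fun S b => insert S b .leaf) S

/-- The leaves of `t` satisfy the bounds if the root of `t` is at depth `d`. -/
def Within (d : ℤ) (t : Tree) (bs : List ℤ) : Prop :=
  List.Forall₂ (fun (l : ℕ) b => d + l ≤ b) t.depths bs

def Fits : List (ℤ × Tree) → List ℤ → Prop
  | [], bs => bs = []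
  | (d, t) :: S, bs => ∃ bs₁ bs₂, bs = bs₁ ++ bs₂ ∧ Fits S bs₁ ∧ Within d t bs₂

def Decreasing (S : List (ℤ × Tree)) : Prop :=
  S.Pairwise fun x y => y.1 < x.1

/-- The total length of the intervals of the trees of a stack. -/
noncomputable def value (S : List (ℤ × Tree)) : ℝ :=
  (S.map fun x => (2 : ℝ) ^ (-x.1)).sum

theorem Within.binary {d₁ d₂ e : ℤ} {t₁ t₂ : Tree} {bs₁ bs₂ : List ℤ} (h₁ : Within d₁ t₁ bs₁)
    (h₂ : Within d₂ t₂ bs₂) (he₁ : e < d₁) (he₂ : e < d₂) :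
    Within e (.binary t₁ t₂) (bs₁ ++ bs₂) := by
  unfold Within
  rw [Tree.depths, List.forall₂_map_left_iff]
  refine List.rel_append (h₁.imp fun l b h => ?_) (h₂.imp fun l b h => ?_) <;>
  · push_cast
    omega

theorem Within.mono {d e : ℤ} {t : Tree} {bs : List ℤ} (h : Within d t bs) (he : e ≤ d) :
    Within e t bs :=
  h.imp fun l b h => by omega

theorem within_leaf (b : ℤ) : Within b .leaf [b] := by
  simp [Within, Tree.depths]

theorem value_cons (d : ℤ) (t : Tree) (S : List (ℤ × Tree)) :
    value ((d, t) :: S) = (2 : ℝ) ^ (-d) + value S := by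
  simp [value]

theorem value_nonneg (S : List (ℤ × Tree)) : 0 ≤ value S := by
  refine List.sum_nonneg fun x hx => ?_
  obtain ⟨y, -, rfl⟩ := List.mem_map.1 hx
  positivity

theorem two_zpow_pred (b : ℤ) : (2 : ℝ) ^ (-(b - 1)) = 2 ^ (-b) + 2 ^ (-b) := by
  rw [show -(b - 1) = -b + 1 by ring, zpow_add_one₀ two_ne_zero]
  ring

/-- As no depth on the stack exceeds `b`, a carry joins two trees of equal depth, so no space is
wasted and the value grows by exactly `2 ^ (-b)`. -/
theorem add_spec {S : List (ℤ × Tree)} {b : ℤ} {t : Tree} {bs₁ bs₂ : List ℤ}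
    (hS : Decreasing S) (hb : ∀ x ∈ S, x.1 ≤ b) (h₁ : Fits S bs₁) (h₂ : Within b t bs₂) :
    Decreasing (add S b t) ∧ (∀ x ∈ add S b t, x.1 ≤ b) ∧ Fits (add S b t) (bs₁ ++ bs₂) ∧
      value (add S b t) = value S + 2 ^ (-b) ∧ add S b t ≠ [] := by
  induction S generalizing b t bs₁ bs₂ with
  | nil =>
    refine ⟨by simp [add, Decreasing], by simp [add], ⟨bs₁, bs₂, rfl, h₁, h₂⟩, ?_, by simp [add]⟩
    rw [add, value_cons]
    ring
  | cons x S ih =>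
    obtain ⟨d, t₁⟩ := x
    rw [add]
    have hS' := List.pairwise_cons.1 hS
    split_ifs with h
    · refine ⟨List.pairwise_cons.2 ⟨?_, hS⟩, ?_, ⟨bs₁, bs₂, rfl, h₁, h₂⟩, ?_, by simp⟩
      · intro y hy
        rcases List.mem_cons.1 hy with rfl | hy
        · exact h
        · exact (hS'.1 y hy).trans h
      · intro y hy
        rcases List.mem_cons.1 hy with rfl | hy
        · exact le_rfl
        · exact hb y hy
      · rw [value_cons]
        ring
    -- The code only tests `d < b`; the invariant turns its failure into equality.
    · obtain rfl : d = b := le_antisymm (hb _ List.mem_cons_self) (not_lt.1 h)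
      obtain ⟨bs₃, bs₄, rfl, h₃, h₄⟩ := h₁
      obtain ⟨i₁, i₂, i₃, i₄, i₅⟩ := ih (b := d - 1) (t := .binary t₁ t) hS'.2
        (fun y hy => by have := hS'.1 y hy; simp only at this; omega) h₃
        (h₄.binary h₂ (by omega) (by omega))
      refine ⟨i₁, fun y hy => (i₂ y hy).trans (by omega), by rwa [List.append_assoc], ?_, i₅⟩
      rw [i₄, value_cons, two_zpow_pred]
      ring

/-- Every interval of the stack has a length that is a multiple of `2 ^ (-b)`. -/
theorem exists_value_eq {S : List (ℤ × Tree)} {b : ℤ} (hb : ∀ x ∈ S, x.1 ≤ b) :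
    ∃ k : ℤ, value S = k * (2 : ℝ) ^ (-b) := by
  induction S with
  | nil => exact ⟨0, by simp [value]⟩
  | cons x S ih =>
    obtain ⟨d, t⟩ := x
    obtain ⟨k, hk⟩ := ih fun y hy => hb y (List.mem_cons_of_mem _ hy)
    obtain ⟨m, hm⟩ := Int.eq_ofNat_of_zero_le (sub_nonneg.2 (hb _ List.mem_cons_self))
    simp only at hm
    refine ⟨2 ^ m + k, ?_⟩
    rw [value_cons, hk, show -d = (m : ℤ) + -b by omega, zpow_add₀ two_ne_zero]
    push_cast
    rw [zpow_natCast]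
    ring

/-- In units of `2 ^ (-b)` the value of `S` is an integer below `k`, hence at most `k - 1`; `acc`
and `t` take one unit each. -/
theorem add_add_spec {S : List (ℤ × Tree)} {b k : ℤ} {acc t : Tree} {bs₁ bs₂ bs₃ : List ℤ}
    (hS : Decreasing S) (hb : ∀ x ∈ S, x.1 ≤ b) (h₁ : Fits S bs₁) (h₂ : Within b acc bs₂)
    (h₃ : Within b t bs₃) :
    Decreasing (add (add S b acc) b t) ∧
      Fits (add (add S b acc) b t) (bs₁ ++ (bs₂ ++ bs₃)) ∧
      (value S < k * (2 : ℝ) ^ (-b) →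
        value (add (add S b acc) b t) ≤ k * (2 : ℝ) ^ (-b) + 2 ^ (-b)) ∧
      add (add S b acc) b t ≠ [] := by
  obtain ⟨i₁, i₂, i₃, i₄, -⟩ := add_spec hS hb h₁ h₂
  obtain ⟨j₁, -, j₃, j₄, j₅⟩ := add_spec i₁ i₂ i₃ h₃
  refine ⟨j₁, by rwa [← List.append_assoc], fun hv => ?_, j₅⟩
  obtain ⟨m, hm⟩ := exists_value_eq hb
  have hpos : (0 : ℝ) < 2 ^ (-b) := by positivity
  rw [hm] at hv
  have hmk : m < k := by exact_mod_cast lt_of_mul_lt_mul_right hv hpos.le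
  have hmk' : (m : ℝ) + 1 ≤ k := by exact_mod_cast hmk
  rw [j₄, i₄, hm]
  nlinarith

/-- Depths on the stack are strictly decreasing, so after `acc` is merged with a tree of depth `d`
into one of depth `d - 1`, the remaining trees are no deeper than that. The strict bound on `value
S` is available because `acc` starts as a tree of positive length taken off the stack. -/
theorem collapse_spec {S : List (ℤ × Tree)} {b e k : ℤ} {acc t : Tree} {bs₁ bs₂ bs₃ : List ℤ}
    (hS : Decreasing S) (he : ∀ x ∈ S, x.1 ≤ e) (hbe : b ≤ e) (h₁ : Fits S bs₁)
    (h₂ : Within e acc bs₂) (h₃ : Within b t bs₃) :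
    Decreasing (collapse S b acc t) ∧ Fits (collapse S b acc t) (bs₁ ++ (bs₂ ++ bs₃)) ∧
      (value S < k * (2 : ℝ) ^ (-b) →
        value (collapse S b acc t) ≤ k * (2 : ℝ) ^ (-b) + 2 ^ (-b)) ∧
      collapse S b acc t ≠ [] := by
  induction S generalizing e acc bs₁ bs₂ with
  | nil => exact add_add_spec hS (by simp) h₁ (h₂.mono hbe) h₃
  | cons x S ih =>
    obtain ⟨d, t₁⟩ := x
    have hS' := List.pairwise_cons.1 hS
    rw [collapse]
    split_ifs with h
    · obtain ⟨bs₄, bs₅, rfl, h₄, h₅⟩ := h₁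
      have hde : d ≤ e := he _ List.mem_cons_self
      obtain ⟨i₁, i₂, i₃, i₄⟩ := ih (e := d - 1) (acc := .binary t₁ acc) hS'.2
        (fun y hy => by have := hS'.1 y hy; simp only at this; omega) (by omega) h₄
        (h₅.binary h₂ (by omega) (by omega))
      refine ⟨i₁, by simpa [List.append_assoc] using i₂, fun hv => i₃ (lt_of_le_of_lt ?_ hv), i₄⟩
      rw [value_cons]
      have : (0 : ℝ) < 2 ^ (-d) := by positivity
      linarith
    · refine add_add_spec hS ?_ h₁ (h₂.mono hbe) h₃
      intro y hy
      rcases List.mem_cons.1 hy with rfl | hy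
      · exact not_lt.1 h
      · exact (hS'.1 y hy).le.trans (not_lt.1 h)

/-- The value is the right end of the packing: it is rounded up to a multiple of `2 ^ (-b)` if
necessary, and then one unit is appended. -/
theorem insert_spec {S : List (ℤ × Tree)} {b k : ℤ} {t : Tree} {bs₁ bs₂ : List ℤ}
    (hS : Decreasing S) (h₁ : Fits S bs₁) (h₂ : Within b t bs₂) :
    Decreasing (insert S b t) ∧ Fits (insert S b t) (bs₁ ++ bs₂) ∧
      (value S ≤ k * (2 : ℝ) ^ (-b) → value (insert S b t) ≤ k * (2 : ℝ) ^ (-b) + 2 ^ (-b)) ∧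
      insert S b t ≠ [] := by
  rcases S with _ | ⟨⟨d, t₁⟩, S⟩
  · obtain ⟨i₁, -, i₃, i₄, i₅⟩ := add_spec hS (b := b) (by simp) h₁ h₂
    exact ⟨i₁, i₃, fun hv => by rw [insert, i₄]; linarith, i₅⟩
  · have hS' := List.pairwise_cons.1 hS
    rw [insert]
    split_ifs with h
    · obtain ⟨bs₃, bs₄, rfl, h₃, h₄⟩ := h₁
      obtain ⟨i₁, i₂, i₃, i₄⟩ := collapse_spec (k := k) hS'.2
        (fun y hy => (hS'.1 y hy).le) h.le h₃ h₄ h₂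
      refine ⟨i₁, by rwa [List.append_assoc], fun hv => i₃ (lt_of_lt_of_le ?_ hv), i₄⟩
      rw [value_cons]
      have : (0 : ℝ) < 2 ^ (-d) := by positivity
      linarith
    · obtain ⟨i₁, -, i₃, i₄, i₅⟩ := add_spec hS (b := b) (t := t) (fun y hy => by
        rcases List.mem_cons.1 hy with rfl | hy
        · exact not_lt.1 h
        · exact (hS'.1 y hy).le.trans (not_lt.1 h)) h₁ h₂
      exact ⟨i₁, i₃, fun hv => by rw [i₄]; linarith, i₅⟩

/-- Feasibility plays no role: carries may push integer depths below zero, which only the bound on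
the value excludes later. -/
theorem insertLeaves_spec {S : List (ℤ × Tree)} {bs₁ bs : List ℤ} (hS : Decreasing S)
    (h₁ : Fits S bs₁) :
    Decreasing (insertLeaves S bs) ∧ Fits (insertLeaves S bs) (bs₁ ++ bs) := by
  induction bs generalizing S bs₁ with
  | nil => exact ⟨hS, by simpa [insertLeaves] using h₁⟩
  | cons b bs ih =>
    obtain ⟨i₁, i₂, -, -⟩ := insert_spec (k := 0) hS h₁ (within_leaf b)
    simpa [insertLeaves] using ih i₁ i₂

theorem exists_append_of_forall₂ {α β : Type*} {R : α → β → Prop} {l₁ l₂ : List α} {l : List β}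
    (h : List.Forall₂ R (l₁ ++ l₂) l) :
    ∃ l₃ l₄, l = l₃ ++ l₄ ∧ List.Forall₂ R l₁ l₃ ∧ List.Forall₂ R l₂ l₄ := by
  induction l₁ generalizing l with
  | nil => exact ⟨[], l, rfl, .nil, h⟩
  | cons a l₁ ih =>
    cases h with
    | cons hab h =>
      obtain ⟨l₃, l₄, rfl, h₃, h₄⟩ := ih h
      exact ⟨_ :: l₃, l₄, rfl, .cons hab h₃, h₄⟩

/-- If a tree satisfies the bounds, the stack does not exceed the interval of that tree. -/
theorem value_insertLeaves_le (T : Tree) {S : List (ℤ × Tree)} {bs₁ bs : List ℤ} {e k : ℤ}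
    (hS : Decreasing S) (h₁ : Fits S bs₁) (hT : Within e T bs)
    (hv : value S ≤ k * (2 : ℝ) ^ (-e)) :
    value (insertLeaves S bs) ≤ k * (2 : ℝ) ^ (-e) + 2 ^ (-e) := by
  -- A subtree with root at depth `e` owns the `k`-th dyadic interval of length `2 ^ (-e)`; its
  -- children own the halves, numbered `2 * k` and `2 * k + 1` at depth `e + 1`.
  induction T generalizing S bs₁ bs e k with
  | leaf =>
    obtain ⟨b, rfl, heb⟩ : ∃ b, bs = [b] ∧ e ≤ b := by
      unfold Within at hT
      simpa [Tree.depths, List.forall₂_cons_left_iff, and_comm] using hT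
    obtain ⟨m, hm⟩ := Int.eq_ofNat_of_zero_le (sub_nonneg.2 heb)
    have he : (2 : ℝ) ^ (-e) = 2 ^ m * 2 ^ (-b) := by
      rw [show -e = (m : ℤ) + -b by omega, zpow_add₀ two_ne_zero, zpow_natCast]
    -- The left end `k * 2 ^ (-e)`, measured in the finer unit `2 ^ (-b)`.
    obtain ⟨-, -, i₃, -⟩ := insert_spec (k := k * 2 ^ m) hS h₁ (within_leaf b)
    have := i₃ (by rw [he] at hv; push_cast; linarith)
    simp only [insertLeaves, List.foldl_cons, List.foldl_nil]
    refine this.trans ?_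
    have hpos : (0 : ℝ) < 2 ^ (-b) := by positivity
    have hone : (1 : ℝ) ≤ 2 ^ m := one_le_pow₀ one_le_two
    rw [he]
    push_cast
    nlinarith
  | unary T ih =>
    have hT' : Within (e + 1) T bs := by
      unfold Within at hT ⊢
      rw [Tree.depths, List.forall₂_map_left_iff] at hT
      refine hT.imp fun l b h => ?_
      push_cast at h
      omega
    have he := two_zpow_pred (e + 1)
    rw [add_sub_cancel_right] at he
    have hpos : (0 : ℝ) < 2 ^ (-(e + 1)) := by positivity
    have := ih (k := 2 * k) hS h₁ hT' (by rw [he] at hv; push_cast; linarith)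
    push_cast at this
    rw [he]
    linarith
  | binary T₁ T₂ ih₁ ih₂ =>
    unfold Within at hT
    rw [Tree.depths, List.forall₂_map_left_iff] at hT
    obtain ⟨bs₃, bs₄, rfl, h₃, h₄⟩ := exists_append_of_forall₂ hT
    have h₃' : Within (e + 1) T₁ bs₃ := h₃.imp fun l b h => by push_cast at h; omega
    have h₄' : Within (e + 1) T₂ bs₄ := h₄.imp fun l b h => by push_cast at h; omega
    have he := two_zpow_pred (e + 1)
    rw [add_sub_cancel_right] at he
    have hv₁ := ih₁ (k := 2 * k) hS h₁ h₃' (by rw [he] at hv; push_cast; linarith)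
    obtain ⟨i₁, i₂⟩ := insertLeaves_spec (bs := bs₃) hS h₁
    have hv₂ := ih₂ (k := 2 * k + 1) i₁ i₂ h₄' (by push_cast at hv₁ ⊢; linarith)
    rw [insertLeaves, List.foldl_append]
    refine hv₂.trans ?_
    rw [he]
    push_cast
    linarith

/-- Each merge yields a root at depth `d - 1`, which is nonnegative since `1 ≤ d`, and by strict
decrease the rest of the stack is no deeper. -/
theorem finish_spec {S : List (ℤ × Tree)} {e : ℤ} {acc : Tree} {bs₁ bs₂ : List ℤ}
    (hS : Decreasing S) (h₁ : Fits S bs₁) (he : 0 ≤ e) (hSe : ∀ x ∈ S, 1 ≤ x.1 ∧ x.1 ≤ e)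
    (h₂ : Within e acc bs₂) : Within 0 (finish S acc) (bs₁ ++ bs₂) := by
  induction S generalizing e acc bs₁ bs₂ with
  | nil =>
    obtain rfl : bs₁ = [] := h₁
    exact h₂.mono he
  | cons x S ih =>
    obtain ⟨d, t⟩ := x
    have hS' := List.pairwise_cons.1 hS
    obtain ⟨bs₃, bs₄, rfl, h₃, h₄⟩ := h₁
    have hd : 1 ≤ d ∧ d ≤ e := hSe _ List.mem_cons_self
    rw [List.append_assoc]
    refine ih (e := d - 1) hS'.2 h₃ (by omega) (fun y hy => ?_)
      (h₄.binary h₂ (by omega) (by omega))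
    have := hS'.1 y hy
    simp only at this
    exact ⟨(hSe y (List.mem_cons_of_mem _ hy)).1, by omega⟩

theorem zpow_le_value {S : List (ℤ × Tree)} {x : ℤ × Tree} (hx : x ∈ S) :
    (2 : ℝ) ^ (-x.1) ≤ value S := by
  induction S with
  | nil => simp at hx
  | cons y S ih =>
    obtain ⟨d, t⟩ := y
    rw [value_cons]
    rcases List.mem_cons.1 hx with rfl | hx
    · linarith [value_nonneg S]
    · have : (0 : ℝ) < 2 ^ (-d) := by positivity
      linarith [ih hx]

/-- Value at most `1` forces the top depth to be nonnegative. Any other tree shares the unit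
interval with the top one, so its length is less than `1` and its depth at least `1`. -/
theorem finishStack_spec {S : List (ℤ × Tree)} {bs : List ℤ} (hS : Decreasing S)
    (h : Fits S bs) (hne : S ≠ []) (hv : value S ≤ 1) : Within 0 (finishStack S) bs := by
  obtain ⟨⟨d, t⟩, S, rfl⟩ := List.exists_cons_of_ne_nil hne
  have hS' := List.pairwise_cons.1 hS
  obtain ⟨bs₁, bs₂, rfl, h₁, h₂⟩ := h
  rw [value_cons] at hv
  have hd : 0 ≤ d := by
    by_contra! hd
    have : (1 : ℝ) < 2 ^ (-d) := one_lt_zpow₀ one_lt_two (by omega)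
    linarith [value_nonneg S]
  refine finish_spec hS'.2 h₁ hd (fun x hx => ⟨?_, (hS'.1 x hx).le⟩) h₂
  by_contra! hx'
  have h₃ : (1 : ℝ) ≤ 2 ^ (-x.1) := one_le_zpow₀ one_le_two (by omega)
  have h₄ : (0 : ℝ) < 2 ^ (-d) := by positivity
  linarith [zpow_le_value hx]

theorem insert_ne_nil (S : List (ℤ × Tree)) (b : ℤ) (t : Tree) : insert S b t ≠ [] := by
  have hadd : ∀ (S : List (ℤ × Tree)) (b : ℤ) (t : Tree), add S b t ≠ [] := by
    intro S
    induction S with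
    | nil => simp [add]
    | cons x S ih =>
      intro b t
      rw [add]
      split_ifs
      · simp
      · exact ih _ _
  have hcollapse : ∀ (S : List (ℤ × Tree)) (b : ℤ) (acc t : Tree), collapse S b acc t ≠ [] := by
    intro S
    induction S with
    | nil => exact fun b acc t => hadd _ _ _
    | cons x S ih =>
      intro b acc t
      rw [collapse]
      split_ifs
      · exact ih _ _ _
      · exact hadd _ _ _
  rcases S with _ | ⟨⟨d, t₁⟩, S⟩
  · exact hadd _ _ _
  · rw [insert]
    split_ifs
    · exact hcollapse _ _ _ _
    · exact hadd _ _ _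

theorem insertLeaves_ne_nil (S : List (ℤ × Tree)) {bs : List ℤ} (h : bs ≠ []) :
    insertLeaves S bs ≠ [] := by
  rw [← List.dropLast_append_getLast h, insertLeaves, List.foldl_append]
  exact insert_ne_nil _ _ _

/-- If some tree satisfies the bounds, the tree that is built does. -/
theorem within_finishStack {T : Tree} {bs : List ℤ} (hbs : bs ≠ []) (hT : Within 0 T bs) :
    Within 0 (finishStack (insertLeaves [] bs)) bs := by
  have hnil : Decreasing [] := List.Pairwise.nil
  obtain ⟨h₁, h₂⟩ := insertLeaves_spec (bs := bs) hnil (bs₁ := []) rfl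
  refine finishStack_spec h₁ h₂ (insertLeaves_ne_nil [] hbs) ?_
  have := value_insertLeaves_le T (k := 0) hnil (bs₁ := []) rfl hT (by simp [value])
  simpa using this

end Stack

/-! ### Amortized running time of the stack functions. -/

section StackCode

variable {W : List ℝ} {D : DataStructure W} {ops : List (Op W.length)}

def encStack : List (ℤ × Tree) → Val
  | [] => .nil
  | (d, t) :: S => .pair (.pair (.num d) (encodeTree t)) (encStack S)

theorem length_add_le (S : List (ℤ × Tree)) (b : ℤ) (t : Tree) :
    (add S b t).length ≤ S.length + 1 := by
  induction S generalizing b t with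
  | nil => simp [add]
  | cons x S ih =>
    rw [add]
    split_ifs
    · simp
    · exact (ih _ _).trans (by simp)

theorem length_collapse_le (S : List (ℤ × Tree)) (b : ℤ) (acc t : Tree) :
    (collapse S b acc t).length ≤ S.length + 2 := by
  induction S generalizing acc with
  | nil => exact (length_add_le (add [] b acc) b t).trans (by simp [add])
  | cons x S ih =>
    rw [collapse]
    split_ifs
    · exact (ih _).trans (by simp)
    · exact (length_add_le _ b t).trans (Nat.add_le_add_right (length_add_le _ b acc) 1)

theorem length_insert_le (S : List (ℤ × Tree)) (b : ℤ) (t : Tree) :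
    (insert S b t).length ≤ S.length + 1 := by
  rcases S with _ | ⟨⟨d, t₁⟩, S⟩
  · exact length_add_le _ _ _
  · rw [insert]
    split_ifs
    · exact length_collapse_le _ _ _ _
    · exact length_add_le _ _ _

/-- The length of the stack is the potential: each carry shortens it and so pays for itself. By
`length_add_le` the subtraction is not truncated. -/
theorem fn_add (S : List (ℤ × Tree)) (b : ℤ) (t : Tree) :
    Fn code D 12 (.pair (encStack S) (.pair (.num b) (encodeTree t))) ops
      (encStack (add S b t)) ops (40 * (S.length + 2 - (add S b t).length)) := by
  induction S generalizing b t with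
  | nil => exact ⟨_, rfl, (Ev.ifNil_nil (.pure rfl) (.pure rfl)).mono (by simp [pureCost, add])⟩
  | cons x S ih =>
    obtain ⟨d, t₁⟩ := x
    rw [add]
    split_ifs with h
    · exact ⟨_, rfl, (Ev.ifNil_pair (.pure rfl) (.ifLt_lt (.pure rfl) (.pure rfl)
        (by exact_mod_cast h) (.pure rfl))).mono (by simp [pureCost])⟩
    · have hrec := ih (b - 1) (.binary t₁ t)
      have hlen := length_add_le S (b - 1) (.binary t₁ t)
      rw [Int.cast_sub] at hrec
      exact ⟨_, rfl, (Ev.ifNil_pair (.pure rfl) (.ifLt_not (.pure rfl) (.pure rfl)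
        (by exact_mod_cast not_lt.1 h) (.call (.pure rfl) hrec))).mono
        (by simp only [pureCost, List.length_cons]; omega)⟩

theorem ev_addTwice (S : List (ℤ × Tree)) (b : ℤ) (acc t : Tree) :
    Ev code D [.pair (encStack S) (.pair (.num b) (.pair (encodeTree acc) (encodeTree t)))]
      addTwiceExpr ops (encStack (add (add S b acc) b t)) ops
      (40 * (S.length + 4 - (add (add S b acc) b t).length) + 40) := by
  have h₁ := length_add_le S b acc
  have h₂ := length_add_le (add S b acc) b t
  exact (Ev.call (.pair (.call (.pure rfl) (fn_add S b acc)) (.pure rfl)) (fn_add _ b t)).mono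
    (by simp only [pureCost]; omega)

theorem fn_collapse (S : List (ℤ × Tree)) (b : ℤ) (acc t : Tree) :
    Fn code D 13
      (.pair (encStack S) (.pair (.num b) (.pair (encodeTree acc) (encodeTree t)))) ops
      (encStack (collapse S b acc t)) ops
      (40 * (S.length + 6 - (collapse S b acc t).length)) := by
  induction S generalizing acc with
  | nil =>
    have := length_collapse_le [] b acc t
    refine ⟨_, rfl, (Ev.ifNil_nil (.pure rfl) (ev_addTwice [] b acc t)).mono ?_⟩
    simp only [pureCost, collapse, List.length_nil] at this ⊢
    omega
  | cons x S ih =>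
    obtain ⟨d, t₁⟩ := x
    have := length_collapse_le ((d, t₁) :: S) b acc t
    rw [collapse] at this ⊢
    split_ifs at this ⊢ with h
    · have hlen := length_collapse_le S b (.binary t₁ acc) t
      exact ⟨_, rfl, (Ev.ifNil_pair (.pure rfl) (.ifLt_lt (.pure rfl) (.pure rfl)
        (by exact_mod_cast h) (.call (.pure rfl) (ih (.binary t₁ acc))))).mono
        (by simp only [pureCost, List.length_cons]; omega)⟩
    · exact ⟨_, rfl, (Ev.ifNil_pair (.pure rfl) (.ifLt_not (.pure rfl) (.pure rfl)
        (by exact_mod_cast not_lt.1 h) (ev_addTwice _ b acc t))).mono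
        (by simp only [pureCost, List.length_cons] at this ⊢; omega)⟩

theorem fn_insert (S : List (ℤ × Tree)) (b : ℤ) (t : Tree) :
    Fn code D 14 (.pair (encStack S) (.pair (.num b) (encodeTree t))) ops
      (encStack (insert S b t)) ops (40 * (S.length + 7 - (insert S b t).length)) := by
  rcases S with _ | ⟨⟨d, t₁⟩, S⟩
  · exact ⟨_, rfl, (Ev.ifNil_nil (.pure rfl) (.call (.pure rfl) (fn_add [] b t))).mono
      (by simp [pureCost, insert, add])⟩
  · have hlen := length_insert_le ((d, t₁) :: S) b t
    rw [insert] at hlen ⊢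
    split_ifs at hlen ⊢ with h
    · exact ⟨_, rfl, (Ev.ifNil_pair (.pure rfl) (.ifLt_lt (.pure rfl) (.pure rfl)
        (by exact_mod_cast h) (.call (.pure rfl) (fn_collapse S b t₁ t)))).mono
        (by simp only [pureCost, List.length_cons] at hlen ⊢; omega)⟩
    · exact ⟨_, rfl, (Ev.ifNil_pair (.pure rfl) (.ifLt_not (.pure rfl) (.pure rfl)
        (by exact_mod_cast not_lt.1 h) (.call (.pure rfl) (fn_add _ b t)))).mono
        (by simp only [pureCost, List.length_cons] at hlen ⊢; omega)⟩

theorem fn_finish (S : List (ℤ × Tree)) (acc : Tree) :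
    Fn code D 15 (.pair (encStack S) (encodeTree acc)) ops (encodeTree (finish S acc)) ops
      (30 * S.length + 10) := by
  induction S generalizing acc with
  | nil => exact ⟨_, rfl, (Ev.ifNil_nil (.pure rfl) (.pure rfl)).mono (by simp [pureCost])⟩
  | cons x S ih =>
    obtain ⟨d, t⟩ := x
    exact ⟨_, rfl, (Ev.ifNil_pair (.pure rfl) (.call (.pure rfl) (ih (.binary t acc)))).mono
      (by simp only [pureCost, List.length_cons]; omega)⟩

/-- The costs of the insertions telescope in the stack length. The hypothesis `h` is needed because
the program takes the top of the stack when the weights run out. -/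
theorem fn_build (c : ℝ) (V : List ℝ) (S : List (ℤ × Tree)) (h : V = [] → S ≠ []) :
    Fn code D 16 (.pair (encodeList V) (.pair (.num c) (encStack S))) ops
      (encodeTree (finishStack (insertLeaves S (V.map fun w => ⌊c - w⌋)))) ops
      (40 * S.length + 400 * V.length + 50) := by
  induction V generalizing S with
  | nil =>
    obtain ⟨⟨d, t⟩, S, rfl⟩ := List.exists_cons_of_ne_nil (h rfl)
    exact ⟨_, rfl, (Ev.ifNil_nil (.pure rfl) (.call (.pure rfl) (fn_finish S t))).mono
      (by simp only [pureCost, List.length_cons]; omega)⟩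
  | cons w V ih =>
    have hins := fn_insert (D := D) (ops := ops) S ⌊c - w⌋ .leaf
    have hlen := length_insert_le S ⌊c - w⌋ .leaf
    rw [show encodeTree .leaf = .num ((0 : ℤ) : ℝ) by simp [encodeTree]] at hins
    have hrec := ih (insert S ⌊c - w⌋ .leaf) fun _ => insert_ne_nil _ _ _
    exact ⟨_, rfl, (Ev.ifNil_pair (.pure rfl) (.call (.pair (.pure rfl) (.pair (.pure rfl)
      (.call (.pure rfl) hins))) hrec)).mono
      (by simp only [pureCost, List.length_cons]; omega)⟩

end StackCode


/-! ## Costs of trees and the threshold -/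

section Cost

theorem finite_costs (W : List ℝ) (T : Tree) :
    {c : ℝ | c ∈ List.zipWith (fun (w : ℝ) (l : ℕ) => w + (l : ℝ)) W T.depths}.Finite :=
  List.finite_toSet _

theorem nonempty_costs {W : List ℝ} {T : Tree} (hW : W ≠ []) (hT : T.depths.length = W.length) :
    {c : ℝ | c ∈ List.zipWith (fun (w : ℝ) (l : ℕ) => w + (l : ℝ)) W T.depths}.Nonempty := by
  refine List.exists_mem_of_ne_nil _ fun h => ?_
  have := congrArg List.length h
  rw [List.length_zipWith, hT, min_self, List.length_nil] at this
  exact hW (List.length_eq_zero_iff.1 this)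

/-- The default `0` of `getD` is never reached, since the lengths agree. -/
theorem forall_costs_iff {W : List ℝ} {T : Tree} (hT : T.depths.length = W.length)
    (P : ℝ → Prop) :
    (∀ c ∈ {c : ℝ | c ∈ List.zipWith (fun (w : ℝ) (l : ℕ) => w + (l : ℝ)) W T.depths}, P c) ↔
      ∀ i : Fin W.length, P (W.get i + (T.depths.getD i.1 0 : ℕ)) := by
  simp only [Set.mem_ofPred_eq, List.forall_mem_iff_forall_getElem, List.length_zipWith,
    List.getElem_zipWith]
  constructor
  · intro h i
    have := h i.1 (by simp [hT])
    rwa [← List.getD_eq_getElem T.depths 0] at this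
  · intro h i hi
    have := h ⟨i, by omega⟩
    rwa [List.getD_eq_getElem _ 0 (by omega)] at this

theorem treeCost_le_iff {W : List ℝ} {T : Tree} (hW : W ≠ []) (hT : T.depths.length = W.length)
    (c : ℝ) :
    treeCost W T ≤ c ↔ ∀ i : Fin W.length, W.get i + (T.depths.getD i.1 0 : ℕ) ≤ c := by
  rw [← forall_costs_iff hT fun x => x ≤ c]
  exact csSup_le_iff (finite_costs W T).bddAbove (nonempty_costs hW hT)

theorem treeCost_lt_iff {W : List ℝ} {T : Tree} (hW : W ≠ []) (hT : T.depths.length = W.length)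
    (c : ℝ) :
    treeCost W T < c ↔ ∀ i : Fin W.length, W.get i + (T.depths.getD i.1 0 : ℕ) < c := by
  rw [← forall_costs_iff hT fun x => x < c]
  exact (finite_costs W T).csSup_lt_iff (nonempty_costs hW hT)

theorem exists_treeCost_eq {W : List ℝ} {T : Tree} (hW : W ≠ [])
    (hT : T.depths.length = W.length) :
    ∃ i : Fin W.length, treeCost W T = W.get i + (T.depths.getD i.1 0 : ℕ) := by
  by_contra! h
  have h' := (treeCost_le_iff hW hT _).1 le_rfl
  exact lt_irrefl _ ((treeCost_lt_iff hW hT _).2 fun i => (h' i).lt_of_ne (h i).symm)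

/-- Depths are integers, so `w + ℓ ≤ c` amounts to `ℓ ≤ ⌊c - w⌋`; this turns a target cost into the
depth bounds of the stack construction. -/
theorem within_floor_iff {W : List ℝ} {T : Tree} (hW : W ≠ []) (c : ℝ) :
    Within 0 T (W.map fun w => ⌊c - w⌋) ↔ T.depths.length = W.length ∧ treeCost W T ≤ c := by
  unfold Within
  rw [List.forall₂_iff_get]
  simp only [List.length_map, List.get_eq_getElem, List.getElem_map, zero_add, Int.le_floor]
  refine and_congr_right fun hT => ?_
  rw [treeCost_le_iff hW hT]
  constructor
  · intro h i
    have := h i.1 (by omega) i.2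
    push_cast at this
    rw [List.getD_eq_getElem _ 0 (by omega)]
    simp only [List.get_eq_getElem]
    linarith
  · intro h i h₁ h₂
    have := h ⟨i, h₂⟩
    rw [List.getD_eq_getElem _ 0 h₁] at this
    simp only [List.get_eq_getElem] at this
    push_cast
    linarith

variable {W : List ℝ}

/-- Some tree has cost less than `m` when the weights of `st` are decreased. -/
def CostLT (W : List ℝ) (m : ℝ) (st : List (Fin W.length)) : Prop :=
  ∃ T : Tree, T.depths.length = W.length ∧ ∀ i : Fin W.length,
    (⌈W.get i⌉ : ℝ) - (if i ∈ st then 1 else 0) + (T.depths.getD i.1 0 : ℕ) < m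

theorem CostLT.mono {m : ℝ} {S S' : List (Fin W.length)} (h : ∀ i ∈ S, i ∈ S')
    (hS : CostLT W m S) : CostLT W m S' := by
  obtain ⟨T, hT, hlt⟩ := hS
  refine ⟨T, hT, fun i => lt_of_le_of_lt ?_ (hlt i)⟩
  gcongr
  split_ifs with h₁ h₂
  · exact le_rfl
  · exact (h₂ (h i h₁)).elim
  · exact zero_le_one
  · exact le_rfl

theorem length_shifted (st : List (Fin W.length)) : (shifted W st).length = W.length := by
  simp [shifted]

theorem getElem_shifted (st : List (Fin W.length)) (i : ℕ) (h : i < (shifted W st).length) :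
    (shifted W st)[i] =
      (⌈W[i]'(length_shifted st ▸ h)⌉ : ℝ) -
        (if (⟨i, length_shifted st ▸ h⟩ : Fin W.length) ∈ st then 1 else 0) := by
  simp [shifted]

theorem shifted_ne_nil (hW : W ≠ []) (st : List (Fin W.length)) : shifted W st ≠ [] := by
  rw [← List.length_pos_iff, length_shifted]
  exact List.length_pos_iff.2 hW

theorem treeCost_shifted_lt_iff (hW : W ≠ []) {st : List (Fin W.length)} {T : Tree}
    (hT : T.depths.length = W.length) (m : ℝ) :
    treeCost (shifted W st) T < m ↔ ∀ i : Fin W.length,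
      (⌈W.get i⌉ : ℝ) - (if i ∈ st then 1 else 0) + (T.depths.getD i.1 0 : ℕ) < m := by
  rw [treeCost_lt_iff (shifted_ne_nil hW st) (hT.trans (length_shifted st).symm)]
  constructor
  · intro h i
    simpa [getElem_shifted] using h ⟨i.1, by simp [shifted]⟩
  · intro h i
    simpa [getElem_shifted] using h ⟨i.1, by simpa [shifted] using i.2⟩

theorem lt_iff_costLT (hW : W ≠ []) {st : List (Fin W.length)} {c : ℝ}
    (hc : IsMinimaxCost (shifted W st) c) (m : ℝ) : c < m ↔ CostLT W m st := by
  obtain ⟨⟨T, hT, rfl⟩, hmin⟩ := hc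
  rw [length_shifted] at hT
  constructor
  · exact fun h => ⟨T, hT, (treeCost_shifted_lt_iff hW hT m).1 h⟩
  · rintro ⟨T', hT', h⟩
    exact (hmin ⟨T', by rwa [length_shifted], rfl⟩).trans_lt
      ((treeCost_shifted_lt_iff hW hT' m).2 h)

/-- `⌈w_i⌉ - w_i`. -/
noncomputable def gap (W : List ℝ) (i : Fin W.length) : ℝ := (⌈W.get i⌉ : ℝ) - W.get i

theorem gap_nonneg (i : Fin W.length) : 0 ≤ gap W i := sub_nonneg.2 (Int.le_ceil _)

theorem gap_lt_one (i : Fin W.length) : gap W i < 1 := by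
  have := Int.ceil_lt_add_one (W.get i)
  unfold gap
  linarith

/-- The cost of the sequence of the numbers `⌈w_i⌉` is an integer. -/
theorem exists_int_eq (hW : W ≠ []) {m : ℝ} (hm : IsMinimaxCost (shifted W []) m) :
    ∃ k : ℤ, m = k := by
  obtain ⟨⟨T, hT, rfl⟩, -⟩ := hm
  obtain ⟨i, hi⟩ := exists_treeCost_eq (shifted_ne_nil hW []) hT
  rw [hi]
  exact ⟨⌈W.get ⟨i.1, by simpa [shifted] using i.2⟩⌉ + (T.depths.getD i.1 0 : ℕ),
    by simp [getElem_shifted]⟩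

/-- Decreasing every weight by `1` lowers the cost of every tree by `1`, so the search starts from a
sufficient set. -/
theorem costLT_finRange (hW : W ≠ []) {m : ℝ} (hm : IsMinimaxCost (shifted W []) m) :
    CostLT W m (List.finRange W.length) := by
  obtain ⟨T, hT, h⟩ := (lt_iff_costLT hW hm (m + 1)).1 (by linarith)
  refine ⟨T, hT, fun i => ?_⟩
  have := h i
  simp only [List.not_mem_nil, if_false, List.mem_finRange, if_true] at this ⊢
  linarith

/-- A tree of cost at most `m - θ` exists, and it is optimal, if `θ` is the largest gap that
admits cost less than `m` when the weights with gaps at least `θ` are decreased. -/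
theorem exists_tree_of_threshold (hW : W ≠ []) {m : ℤ} {i₀ : Fin W.length}
    (h : CostLT W m ((List.finRange W.length).filter fun i => gap W i₀ ≤ gap W i)) :
    ∃ T : Tree, T.depths.length = W.length ∧ treeCost W T ≤ m - gap W i₀ := by
  obtain ⟨T, hT, h⟩ := h
  refine ⟨T, hT, (treeCost_le_iff hW hT _).2 fun i => ?_⟩
  have hi := h i
  simp only [List.mem_filter, List.mem_finRange, true_and, decide_eq_true_eq] at hi
  have h₀ := gap_lt_one i₀
  have h₁ := gap_nonneg i
  have hw : (⌈W.get i⌉ : ℝ) = W.get i + gap W i := by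
    unfold gap
    ring
  -- By integrality, less than `m` means at most `m - 1`. Subtracting the gap then leaves `m - gap W
  -- i ≤ m - gap W i₀` for decreased weights, and for the others at most `m - 1`, which suffices as
  -- `gap W i₀ < 1`.
  have hint : (⌈W.get i⌉ : ℝ) - (if gap W i₀ ≤ gap W i then 1 else 0) +
      (T.depths.getD i.1 0 : ℕ) ≤ m - 1 := by
    split_ifs at hi ⊢
    · have : ⌈W.get i⌉ - 1 + (T.depths.getD i.1 0 : ℤ) < m := by exact_mod_cast hi
      exact_mod_cast Int.le_sub_one_of_lt this
    · rw [sub_zero] at hi ⊢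
      have : ⌈W.get i⌉ + (T.depths.getD i.1 0 : ℤ) < m := by exact_mod_cast hi
      exact_mod_cast Int.le_sub_one_of_lt this
  split_ifs at hint <;> linarith

/-- A cheaper tree would have `⌈w_i⌉ + ℓ_i < m - gap W i₀ + gap W i`. This is at most `m` if `gap W
i ≤ gap W i₀`, and below `m + 1` otherwise, so the tree would witness `CostLT` with only the
strictly larger gaps decreased. -/
theorem le_treeCost_of_threshold (hW : W ≠ []) {m : ℝ} {i₀ : Fin W.length}
    (h : ¬ CostLT W m ((List.finRange W.length).filter fun i => gap W i₀ < gap W i))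
    {T : Tree} (hT : T.depths.length = W.length) : m - gap W i₀ ≤ treeCost W T := by
  by_contra! hlt
  refine h ⟨T, hT, fun i => ?_⟩
  have hi := (treeCost_lt_iff hW hT _).1 hlt i
  simp only [List.mem_filter, List.mem_finRange, true_and, decide_eq_true_eq]
  have h₀ := gap_nonneg i₀
  have h₁ := gap_lt_one i
  have hw : (⌈W.get i⌉ : ℝ) = W.get i + gap W i := by
    unfold gap
    ring
  split_ifs with hg
  · linarith
  · linarith

end Cost

/-! ## The main expression -/

section Main

variable {W : List ℝ} {D : DataStructure W}

theorem fn_items (ops : List (Op W.length)) (k : ℕ) :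
    Fn code D 0 (.pair (.num ((k : ℝ) + 1)) (encodeList (W.drop k))) ops
      (encItems (gap W) position ((List.finRange W.length).drop k)) ops
      (40 * (W.length - k) + 10) := by
  rcases le_or_gt W.length k with h | h
  · rw [List.drop_eq_nil_of_le h, List.drop_eq_nil_of_le (by simpa using h)]
    exact ⟨_, rfl, (Ev.ifNil_nil (.pure rfl) (.pure rfl)).mono (by simp [pureCost])⟩
  · have ih := fn_items ops (k + 1)
    rw [List.drop_eq_getElem_cons h,
      List.drop_eq_getElem_cons (l := List.finRange W.length) (by simpa using h)]
    rw [show ((k + 1 : ℕ) : ℝ) + 1 = (k : ℝ) + 1 + ((1 : ℤ) : ℝ) by push_cast; ring] at ih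
    refine ⟨_, rfl, (Ev.ifNil_pair (.pure rfl) (.pair (.pure rfl)
      (.call (.pure rfl) ih))).cast ?_ ?_⟩
    -- The program computes `⌈w⌉` as `0 - ⌊0 - w⌋`.
    · simp [encItems, encItem, gap, position, Int.floor_neg]
    · simp only [pureCost]
      omega
termination_by W.length - k

theorem exists_build (hW : W ≠ []) (hD : D.Correct) :
    ∃ (T : Tree) (ops : List (Op W.length)), IsMinimaxTree W T ∧ (effects ops).isSome ∧
      ops.length ≤ 71 * W.length ∧
      Ev code D [encodeList W] mainBody [] (encodeTree T) ops (31000 * W.length) := by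
  have hlen := List.length_pos_iff.2 hW
  have hm : IsMinimaxCost (shifted W []) (D.answer (D.stateAfter [])) := hD [] [] rfl
  set m := D.answer (D.stateAfter []) with hmdef
  obtain ⟨k, hk⟩ := exists_int_eq hW hm
  -- The search starts after the single operation `cost` that returned `m`; with the `70 * W.length`
  -- of the search this stays within `71 * W.length`.
  obtain ⟨θ, ops, ⟨i₀, -, rfl⟩, hops, hlen', hsearch, h₁, h₂⟩ :=
    fn_search (D := D) (key := gap W) (m := m) (Good := CostLT W m)
      (fun _ _ h => CostLT.mono h) (fun ops st h => lt_iff_costLT hW (hD ops st h) m)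
      (List.finRange W.length) [] [.cost] rfl
      (fun h => lt_irrefl _ ((lt_iff_costLT hW hm m).2 h))
      (by rw [List.append_nil]; exact costLT_finRange hW hm)
  rw [List.append_nil] at h₁ h₂
  rw [List.length_finRange] at hlen' hsearch
  have hbs : (W.map fun w => ⌊m - gap W i₀ - w⌋) ≠ [] := by simpa using hW
  obtain ⟨T', hT', hle'⟩ := exists_tree_of_threshold hW (hk ▸ h₁)
  rw [← hk] at hle'
  obtain ⟨hT, hle⟩ := (within_floor_iff hW _).1
    (within_finishStack hbs ((within_floor_iff hW _).2 ⟨hT', hle'⟩))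
  refine ⟨_, ops, ⟨hT, fun T'' hT'' => hle.trans (le_treeCost_of_threshold hW h₂ hT'')⟩, hops,
    ?_, ?_⟩
  · simp only [List.length_singleton] at hlen'
    omega
  · have hitems := fn_items (D := D) [] 0
    rw [show ((0 : ℕ) : ℝ) + 1 = ((1 : ℤ) : ℝ) by simp, List.drop_zero, List.drop_zero] at hitems
    refine Ev.mono (.bind (.call (.pure rfl) hitems) (.bind .cost
      (.bind (.call (.pure rfl) hsearch)
        (.call (.pure rfl) (fn_build (m - gap W i₀) W [] fun h => (hW h).elim))))) ?_
    simp only [pureCost, List.length_nil]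
    omega

/-- From `2 ^ (3/2) ≤ 3` and `2 ^ (1/2) ≤ 3/2` it follows that `log log n ≥ 1/2`; both are checked
by squaring. Moreover `d ≥ 1`. -/
theorem half_length_le_bound (h : 3 ≤ W.length) : (W.length : ℝ) / 2 ≤ bound W := by
  have hn : (3 : ℝ) ≤ W.length := by exact_mod_cast h
  have h₁ : (3 / 2 : ℝ) ≤ Real.logb 2 W.length := by
    rw [Real.le_logb_iff_rpow_le one_lt_two (by linarith)]
    refine le_trans ?_ hn
    refine le_of_sq_le_sq ?_ (by norm_num)
    rw [← Real.rpow_natCast, ← Real.rpow_mul (by norm_num)]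
    norm_num
  have h₂ : (1 / 2 : ℝ) ≤ Real.logb 2 (Real.logb 2 W.length) := by
    rw [Real.le_logb_iff_rpow_le one_lt_two (by linarith)]
    refine le_trans ?_ h₁
    refine le_of_sq_le_sq ?_ (by norm_num)
    rw [← Real.rpow_natCast, ← Real.rpow_mul (by norm_num)]
    norm_num
  have h₃ : (1 : ℝ) ≤ numCeils W := by
    have : 0 < numCeils W := by
      unfold numCeils
      rw [Finset.card_pos, List.toFinset_nonempty_iff]
      intro h'
      rw [List.map_eq_nil_iff] at h'
      simp [h'] at h
    exact_mod_cast this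
  unfold bound
  calc (W.length : ℝ) / 2 = W.length * 1 * (1 / 2) := by ring
    _ ≤ _ := by gcongr

end Main

end AlphabeticMinimax

theorem lemma1 :
    ∃ P : AlphabeticMinimax.Program,
      ∀ D : (W : List ℝ) → AlphabeticMinimax.DataStructure W,
        (∀ W : List ℝ, W ≠ [] → (D W).Correct) →
        AlphabeticMinimax.FastOnLinearSequences D →
        ∃ C : ℝ, ∀ W : List ℝ, W ≠ [] →
          ∃ (T : AlphabeticMinimax.Tree) (t : ℕ),
            P.Builds (D W) T t ∧
            AlphabeticMinimax.IsMinimaxTree W T ∧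
            (3 ≤ W.length → (t : ℝ) ≤ C * AlphabeticMinimax.bound W) := by
  refine ⟨⟨AlphabeticMinimax.code, AlphabeticMinimax.mainBody⟩, fun D hD hfast => ?_⟩
  obtain ⟨C, hC⟩ := hfast 71
  -- The program's own `31000 * n` steps are `62000 * (n / 2)`.
  refine ⟨C + 62000, fun W hW => ?_⟩
  obtain ⟨T, ops, hT, hops, hlen, t, heval, ht⟩ :=
    AlphabeticMinimax.exists_build hW (hD W hW)
  refine ⟨T, (D W).buildTime + t, ⟨_, t, heval, rfl⟩, hT, fun hn => ?_⟩
  have h₁ := hC W hn ops hops hlen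
  have h₂ := AlphabeticMinimax.half_length_le_bound hn
  have h₃ : (D W).buildTime + t ≤ 31000 * W.length + (D W).totalTime ops := by
    unfold AlphabeticMinimax.DataStructure.totalTime
    simp only [AlphabeticMinimax.DataStructure.timeFrom] at ht
    omega
  have h₄ : (((D W).buildTime + t : ℕ) : ℝ) ≤ 31000 * W.length + (D W).totalTime ops := by
    exact_mod_cast h₃
  linarith
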